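/- For an algebraic number $\alpha$ let $H(\alpha)$ be the maximum of the absolute values of the coefficients of its minimal polynomial over $\mathbb{Z}$. For a real (resp. non-real complex) number $z$ and an integer $n\ge 1$ let $\omega^*_n(z)\in[0,\infty]$ be the supremum of the real numbers $\omega>0$ for which there exist infinitely many real (resp. complex) algebraic numbers $\alpha$ of degree exactly $n$ with $0<|z-\alpha|<H(\alpha)^{-\omega-1}$. For $m\ge1$, call $z$ a $U$-number of type $m$ if $\omega^*_m(z)=\infty$ and $\omega^*_n(z)<\infty$ for all $1\le n<m$, and let $\mathbb{U}_m$ be the set of real $U$-numbers of type $m$ (the $U_m$-numbers). Let $\overline{\mathbb{Q}}\subset\mathbb{C}$ be the field of algebraic numbers and $\ell=\sum_{n\ge1}10^{-n!}$. Let $m\ge 1$ be an integer. For every $\xi\in\mathbb{U}_m$ and every non-constant rational function $F\in\overline{\mathbb{Q}}(x)$, the point $\xi$ is not a pole of $F$ and $F(\xi)$ is a $U$-number of exactly one type $\psi(\xi,F)\geq 1$; that is, $\psi:\mathbb{U}_m\times(\overline{\mathbb{Q}}(x)\setminus\overline{\mathbb{Q}})\to\mathbb{Z}_{\ge1}$,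 with $\psi(\xi,F)$ the type of $F(\xi)$, is well defined. For every integer $s\ge1$ the set $\psi^{-1}(s)$ is infinite; in particular, $\psi$ is surjective onto $\mathbb{Z}_{\ge 1}$. Moreover, for every $s\geq1$ the family $(1/\xi)_{\xi\in\pi_1(\psi^{-1}(s))}$ is not summable, that is, $\sum_{\xi\in\pi_1(\psi^{-1}(s))}1/\xi$ diverges, where $\pi_1(\xi,F)=\xi$. Indeed, for every $s\ge1$ and every prime $p$ the pair $(p^{1/m}\ell,\ 2^{1/s}x^m)$ belongs to $\psi^{-1}(s)$, and $\sum_{p\text{ prime}}1/(p^{1/m}\ell)=\infty$. -/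

import Mathlib

open Polynomial

noncomputable section

namespace Koksma

/-- The minimal polynomial over `ℤ` of an algebraic number `α`, up to sign: the primitive part
of the polynomial obtained from `minpoly ℚ α` by clearing denominators. -/
def intMinpoly (α : ℂ) : ℤ[X] :=
  (IsLocalization.integerNormalization (nonZeroDivisors ℤ) (minpoly ℚ α)).primPart

/-- The height `H(α)`: the maximum of the absolute values of the coefficients of the minimal
polynomial of `α` over `ℤ`. -/
def height (α : ℂ) : ℝ := (intMinpoly α).supNorm

/-- The algebraic numbers `α` of exact degree `n` with `0 < |z - α| < H(α) ^ (-w - 1)`.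
As usual, a real number is approximated by real algebraic numbers, and a non-real complex number
by complex algebraic numbers. -/
def approximants (n : ℕ) (w : ℝ) (z : ℂ) : Set ℂ :=
  {α | IsAlgebraic ℚ α ∧ (minpoly ℚ α).natDegree = n ∧ (z.im = 0 → α.im = 0) ∧
    0 < ‖z - α‖ ∧ ‖z - α‖ < height α ^ (-w - 1)}

/-- Koksma's exponent `ω*_n(z)`, an element of `[0, ∞]`: the supremum of the positive real `w` for
which there are infinitely many algebraic numbers of degree `n` approximating `z` to order `w`. -/
def omegaStar (n : ℕ) (z : ℂ) : ENNReal :=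
  ⨆ (w : ℝ) (_ : 0 < w ∧ (approximants n w z).Infinite), ENNReal.ofReal w

/-- `z` is a `U`-number of type `m`: `ω*_m(z) = ∞` and `ω*_n(z) < ∞` for `1 ≤ n < m`. -/
def IsUNumber (m : ℕ) (z : ℂ) : Prop :=
  1 ≤ m ∧ omegaStar m z = ⊤ ∧ ∀ n : ℕ, 1 ≤ n → n < m → omegaStar n z < ⊤

/-- The set of real `U_m`-numbers. -/
def UNumbers (m : ℕ) : Set ℝ := {ξ | IsUNumber m (ξ : ℂ)}

/-- The field of algebraic numbers, as a subfield of `ℂ`. -/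
abbrev Qbar : IntermediateField ℚ ℂ := algebraicClosure ℚ ℂ

/-- The non-constant rational functions in one variable with algebraic coefficients. -/
def NonconstRatFunc : Set (RatFunc Qbar) := {F | ∀ c : Qbar, F ≠ RatFunc.C c}

/-- The value `F(z)` of a rational function at a complex number that is not a pole. -/
def value (F : RatFunc Qbar) (z : ℂ) : ℂ := F.eval (algebraMap Qbar ℂ) z

/-- `z` is a pole of `F`, which is in lowest terms. -/
def IsPole (F : RatFunc Qbar) (z : ℂ) : Prop := F.denom.eval₂ (algebraMap Qbar ℂ) z = 0

/-- `ψ` maps each pair `(ξ, F)`, with `ξ` a `U_m`-number and `F` non-constant, to the type of the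
`U`-number `F(ξ)`; this includes that `F(ξ)` is defined and is a `U`-number. -/
def IsTypeMap (m : ℕ) (ψ : UNumbers m × NonconstRatFunc → ℕ+) : Prop :=
  ∀ (ξ : UNumbers m) (F : NonconstRatFunc),
    ¬ IsPole F.1 ((ξ.1 : ℝ) : ℂ) ∧ IsUNumber (ψ (ξ, F) : ℕ) (value F.1 ((ξ.1 : ℝ) : ℂ))

/-- The Liouville constant `∑_{n ≥ 1} 10 ^ (-n!)`. -/
def liouvilleConstant : ℝ := ∑' n : ℕ, (1 / 10 : ℝ) ^ (n + 1).factorial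

end Koksma

end

/-! The proof has two halves. The first shows that `F(ξ)` is a `U`-number. Liouville's inequality
makes a `U`-number `ξ` transcendental, so it is not a pole of `F`, and `F(ξ)` is transcendental too.
There is an integral relation `G(ξ, F(ξ)) = 0`. It persists at algebraic points, and eliminating `x`
with a resultant shows that if `α` has degree `m`, then `F(α)` has bounded degree and height at most
`K * H(α) ^ e`, outside a finite set (`exists_height_div_le`). Since `F` is Lipschitz at `ξ`, good
approximations `α` of `ξ` give good approximations `F(α)` of `F(ξ)`. The pigeonhole principle over
the finitely many degrees then yields an `n` with `ω*_n(F(ξ)) = ∞`, and the least such `n` is the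
type (`IsUNumber.div`).

The second half produces explicit values: `θ * ℓ ^ j` has type `d` when `θ ≠ 0` is real algebraic of
degree `d` and `j ≥ 1` (`isUNumber_mul_liouville`). Replacing `ℓ` by its partial sums gives
excellent approximations of degree `d`. A number of degree `n < d` is conjugate to none of them, so
Liouville's inequality keeps it away from them and hence from `θ * ℓ ^ j`. For `ξ = p^{1/m} ℓ` and
`F = 2^{1/s} x^m` this gives `F(ξ) = 2^{1/s} p ℓ^m`, of type `s`. Letting `p` vary over the primes
gives infinitude and divergence. -/

noncomputable section

namespace Koksma

/-! ### Mahler measure of integer polynomials, compared with the height. -/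

/-- The Mahler measure of an integer polynomial. -/
def intMahler (P : ℤ[X]) : ℝ := (P.map (Int.castRingHom ℂ)).mahlerMeasure

lemma one_le_intMahler {P : ℤ[X]} (hP : P ≠ 0) : 1 ≤ intMahler P :=
  one_le_mahlerMeasure_of_ne_zero hP

lemma intMahler_mul (P Q : ℤ[X]) : intMahler (P * Q) = intMahler P * intMahler Q := by
  simp [intMahler, mahlerMeasure_mul]

lemma natDegree_map_intCast (P : ℤ[X]) :
    (P.map (Int.castRingHom ℂ)).natDegree = P.natDegree :=
  natDegree_map_eq_of_injective (Int.castRingHom ℂ).injective_int P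

lemma map_intCast_ne_zero {P : ℤ[X]} (hP : P ≠ 0) : P.map (Int.castRingHom ℂ) ≠ 0 :=
  (Polynomial.map_ne_zero_iff (Int.castRingHom ℂ).injective_int).2 hP

lemma supNorm_map_intCast (P : ℤ[X]) : (P.map (Int.castRingHom ℂ)).supNorm = P.supNorm := by
  apply le_antisymm
  · obtain ⟨i, hi⟩ := (P.map (Int.castRingHom ℂ)).exists_eq_supNorm
    rw [hi, coeff_map, eq_intCast, Complex.norm_intCast, ← Int.norm_eq_abs]
    exact P.le_supNorm i
  · obtain ⟨i, hi⟩ := P.exists_eq_supNorm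
    have h := (P.map (Int.castRingHom ℂ)).le_supNorm i
    rwa [coeff_map, eq_intCast, Complex.norm_intCast, ← Int.norm_eq_abs, ← hi] at h

lemma supNorm_le_intMahler (P : ℤ[X]) : P.supNorm ≤ 2 ^ P.natDegree * intMahler P := by
  have h := (P.map (Int.castRingHom ℂ)).supNorm_le_choose_natDegree_div_two_mul_mahlerMeasure
  rw [supNorm_map_intCast, natDegree_map_intCast] at h
  refine h.trans ?_
  refine mul_le_mul_of_nonneg_right ?_ (mahlerMeasure_nonneg _)
  exact_mod_cast Nat.choose_le_two_pow _ _

lemma intMahler_le_supNorm (P : ℤ[X]) : intMahler P ≤ (P.natDegree + 1) * P.supNorm := by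
  have h := (P.map (Int.castRingHom ℂ)).mahlerMeasure_le_sqrt_natDegree_add_one_mul_supNorm
  rw [supNorm_map_intCast, natDegree_map_intCast] at h
  refine h.trans (mul_le_mul_of_nonneg_right ?_ P.supNorm_nonneg)
  rw [Real.sqrt_le_left (by positivity)]
  nlinarith [(Nat.cast_nonneg P.natDegree : (0 : ℝ) ≤ P.natDegree)]

/-! ### Integral minimal polynomials and Northcott finiteness. -/

section IntMinpoly

variable {α : ℂ}

lemma intMinpoly_ne_zero : intMinpoly α ≠ 0 :=
  (isPrimitive_primPart _).ne_zero

lemma exists_map_intMinpoly (hα : IsAlgebraic ℚ α) :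
    ∃ c : ℚ, c ≠ 0 ∧ (intMinpoly α).map (algebraMap ℤ ℚ) = C c * minpoly ℚ α := by
  obtain ⟨b, hb, h⟩ :=
    IsLocalization.integerNormalization_spec (nonZeroDivisors ℤ) (minpoly ℚ α)
  set N := IsLocalization.integerNormalization (nonZeroDivisors ℤ) (minpoly ℚ α) with hN
  have hN0 : N ≠ 0 := by
    rw [hN, Ne, IsFractionRing.integerNormalization_eq_zero_iff]
    exact minpoly.ne_zero hα.isIntegral
  have hc : (N.content : ℚ) ≠ 0 := by
    exact_mod_cast fun h0 => hN0 (content_eq_zero_iff.1 h0)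
  have hb' : (b : ℚ) ≠ 0 := by exact_mod_cast nonZeroDivisors.ne_zero hb
  -- Clearing denominators multiplies by `b`; passing to the primitive part divides by the content.
  refine ⟨(N.content : ℚ)⁻¹ * b, mul_ne_zero (inv_ne_zero hc) hb', ?_⟩
  have h2 : N.map (algebraMap ℤ ℚ) = C (N.content : ℚ) * (intMinpoly α).map (algebraMap ℤ ℚ) := by
    conv_lhs => rw [N.eq_C_content_mul_primPart]
    rw [Polynomial.map_mul, map_C]
    rfl
  have h3 : C (b : ℚ) * minpoly ℚ α =
      C (N.content : ℚ) * (intMinpoly α).map (algebraMap ℤ ℚ) := by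
    rw [← h2, h]
    ext i
    simp
  rw [C_mul, mul_assoc, h3, ← mul_assoc, ← C_mul, inv_mul_cancel₀ hc, C_1, one_mul]

lemma natDegree_intMinpoly (hα : IsAlgebraic ℚ α) :
    (intMinpoly α).natDegree = (minpoly ℚ α).natDegree := by
  obtain ⟨c, hc, h⟩ := exists_map_intMinpoly hα
  rw [← natDegree_C_mul hc (p := minpoly ℚ α), ← h,
    natDegree_map_eq_of_injective (algebraMap ℤ ℚ).injective_int]

lemma aeval_intMinpoly_eq_zero_iff (hα : IsAlgebraic ℚ α) (x : ℂ) :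
    aeval x (intMinpoly α) = 0 ↔ aeval x (minpoly ℚ α) = 0 := by
  obtain ⟨c, hc, h⟩ := exists_map_intMinpoly hα
  rw [← aeval_map_algebraMap ℚ x (intMinpoly α), h]
  simp [hc]

lemma aeval_intMinpoly (hα : IsAlgebraic ℚ α) : aeval α (intMinpoly α) = 0 :=
  (aeval_intMinpoly_eq_zero_iff hα α).2 (minpoly.aeval _ _)

lemma minpoly_eq_of_aeval_intMinpoly (hα : IsAlgebraic ℚ α) {x : ℂ}
    (hx : aeval x (intMinpoly α) = 0) : minpoly ℚ α = minpoly ℚ x :=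
  minpoly.eq_of_irreducible_of_monic (minpoly.irreducible hα.isIntegral)
    ((aeval_intMinpoly_eq_zero_iff hα x).1 hx) (minpoly.monic hα.isIntegral)

/-- Gauss's lemma: divisibility by a primitive polynomial descends from `ℚ` to `ℤ`. -/
lemma intMinpoly_dvd (hα : IsAlgebraic ℚ α) {Q : ℤ[X]} (hQ : aeval α Q = 0) :
    intMinpoly α ∣ Q := by
  obtain ⟨c, hc, h⟩ := exists_map_intMinpoly hα
  refine (isPrimitive_primPart _).dvd_of_fraction_map_dvd_fraction_map (K := ℚ) ?_
  have h1 : minpoly ℚ α ∣ Q.map (algebraMap ℤ ℚ) := by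
    apply minpoly.dvd
    rwa [aeval_map_algebraMap]
  change (intMinpoly α).map (algebraMap ℤ ℚ) ∣ _
  rw [h]
  exact (C_mul_dvd hc).2 h1

/-- The cofactor is a nonzero integer polynomial, so its Mahler measure is at least 1. This
multiplicativity is why Mahler measure is used instead of the height. -/
lemma intMahler_intMinpoly_le (hα : IsAlgebraic ℚ α) {Q : ℤ[X]} (hQ0 : Q ≠ 0)
    (hQ : aeval α Q = 0) : intMahler (intMinpoly α) ≤ intMahler Q := by
  obtain ⟨R, rfl⟩ := intMinpoly_dvd hα hQ
  rw [intMahler_mul]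
  exact le_mul_of_one_le_right (mahlerMeasure_nonneg _)
    (one_le_intMahler (right_ne_zero_of_mul hQ0))

lemma natDegree_minpoly_le (hα : IsAlgebraic ℚ α) {Q : ℤ[X]} (hQ0 : Q ≠ 0)
    (hQ : aeval α Q = 0) : (minpoly ℚ α).natDegree ≤ Q.natDegree := by
  rw [← natDegree_intMinpoly hα]
  exact natDegree_le_of_dvd (intMinpoly_dvd hα hQ) hQ0

lemma height_le (hα : IsAlgebraic ℚ α) {Q : ℤ[X]} (hQ0 : Q ≠ 0)
    (hQ : aeval α Q = 0) : height α ≤ 2 ^ Q.natDegree * intMahler Q := by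
  refine (supNorm_le_intMahler _).trans ?_
  gcongr
  · exact mahlerMeasure_nonneg _
  · norm_num
  · rw [natDegree_intMinpoly hα]; exact natDegree_minpoly_le hα hQ0 hQ
  · exact intMahler_intMinpoly_le hα hQ0 hQ

lemma one_le_height (α : ℂ) : 1 ≤ height α := by
  have h := (intMinpoly α).le_supNorm (intMinpoly α).natDegree
  refine le_trans ?_ h
  rw [Int.norm_eq_abs]
  exact_mod_cast Int.one_le_abs (leadingCoeff_ne_zero.2 intMinpoly_ne_zero)

lemma height_pos (α : ℂ) : 0 < height α := zero_lt_one.trans_le (one_le_height α)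

lemma intMahler_intMinpoly_le_height (hα : IsAlgebraic ℚ α) :
    intMahler (intMinpoly α) ≤ ((minpoly ℚ α).natDegree + 1) * height α := by
  rw [← natDegree_intMinpoly hα]
  exact intMahler_le_supNorm _

end IntMinpoly

/-- There are only finitely many algebraic numbers of given degree and bounded height. -/
lemma finite_height_le (n : ℕ) (B : ℝ) :
    {α : ℂ | IsAlgebraic ℚ α ∧ (minpoly ℚ α).natDegree = n ∧ height α ≤ B}.Finite := by
  set b : NNReal := ((n + 1) * B).toNNReal with hb
  refine ((finite_mahlerMeasure_le n b).biUnion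
    (t := fun P => {x : ℂ | P ≠ 0 ∧ aeval x P = 0}) fun P _ => ?_).subset ?_
  · by_cases hP : P = 0
    · simp [hP]
    · refine (P.rootSet_finite ℂ).subset fun x hx => ?_
      exact (mem_rootSet_of_ne hP).2 hx.2
  · rintro α ⟨hα, hn, hB⟩
    simp only [Set.mem_iUnion]
    refine ⟨intMinpoly α, ⟨(natDegree_intMinpoly hα).trans hn |>.le, ?_⟩, intMinpoly_ne_zero,
      aeval_intMinpoly hα⟩
    refine (intMahler_intMinpoly_le_height hα).trans ?_
    rw [hn]
    refine le_trans ?_ (Real.le_coe_toNNReal _)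
    gcongr

/-! ### Liouville's inequality. -/

/-- A polynomial of Mahler measure `M` and degree `n` is bounded by `2 ^ n * M * max 1 |x| ^ n`. -/
lemma norm_eval_le (S : ℂ[X]) (x : ℂ) :
    ‖S.eval x‖ ≤ 2 ^ S.natDegree * S.mahlerMeasure * max 1 ‖x‖ ^ S.natDegree := by
  have hs := IsAlgClosed.splits S
  have h1 : S.eval x = S.leadingCoeff * (S.roots.map fun a => x - a).prod := by
    conv_lhs => rw [hs.eq_prod_roots]
    simp [eval_multiset_prod]
  rw [h1, norm_mul, mahlerMeasure_eq_leadingCoeff_mul_prod_roots, hs.natDegree_eq_card_roots]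
  have h2 : ‖(S.roots.map fun a => x - a).prod‖ ≤
      2 ^ S.roots.card * (S.roots.map fun a => max 1 ‖a‖).prod * max 1 ‖x‖ ^ S.roots.card := by
    induction S.roots using Multiset.induction_on with
    | empty => simp
    | cons a s ih =>
      simp only [Multiset.map_cons, Multiset.prod_cons, Multiset.card_cons, norm_mul]
      have h3 : ‖x - a‖ ≤ 2 * max 1 ‖a‖ * max 1 ‖x‖ := by
        have := norm_sub_le x a
        have h4 := le_max_left 1 ‖a‖
        have h5 := le_max_right 1 ‖a‖
        have h6 := le_max_left 1 ‖x‖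
        have h7 := le_max_right 1 ‖x‖
        nlinarith
      calc _ ≤ (2 * max 1 ‖a‖ * max 1 ‖x‖) * _ := mul_le_mul h3 ih (norm_nonneg _) (by positivity)
        _ = _ := by ring
  calc _ ≤ _ := mul_le_mul_of_nonneg_left h2 (norm_nonneg _)
    _ = _ := by ring

/-- Dividing by `X - β`, whose Mahler measure is `max 1 ‖β‖ ≥ 1`, does not increase the Mahler
measure. -/
lemma norm_eval_le_of_root (Q : ℂ[X]) (hQ : Q ≠ 0) {β : ℂ} (hβ : Q.eval β = 0) (x : ℂ) :
    ‖Q.eval x‖ ≤ ‖x - β‖ * (2 ^ Q.natDegree * Q.mahlerMeasure * max 1 ‖x‖ ^ Q.natDegree) := by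
  obtain ⟨S, rfl⟩ := dvd_iff_isRoot.2 hβ
  have hS : S ≠ 0 := right_ne_zero_of_mul hQ
  rw [eval_mul, norm_mul, natDegree_mul (X_sub_C_ne_zero _) hS, mahlerMeasure_mul,
    mahlerMeasure_X_sub_C]
  simp only [eval_sub, eval_X, eval_C, natDegree_X_sub_C]
  refine mul_le_mul_of_nonneg_left ((norm_eval_le S x).trans ?_) (norm_nonneg _)
  have := S.mahlerMeasure_nonneg
  gcongr
  · norm_num
  · omega
  · exact le_mul_of_one_le_left this (le_max_left _ _)
  · exact le_max_left _ _
  · omega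

/-- Liouville's inequality. -/
lemma one_le_of_no_common_root {P Q : ℤ[X]} (hP0 : P ≠ 0) (hQ0 : Q ≠ 0)
    (hPQ : ∀ x : ℂ, aeval x P = 0 → aeval x Q ≠ 0) {α β : ℂ} (hα : aeval α P = 0)
    (hβ : aeval β Q = 0) :
    1 ≤ ‖α - β‖ * (2 ^ (P.natDegree * Q.natDegree) * intMahler Q ^ P.natDegree *
      intMahler P ^ Q.natDegree) := by
  set p := P.map (Int.castRingHom ℂ) with hp
  set q := Q.map (Int.castRingHom ℂ) with hq
  have hp0 : p ≠ 0 := map_intCast_ne_zero hP0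
  have hq0 : q ≠ 0 := map_intCast_ne_zero hQ0
  have evp : ∀ x, p.eval x = aeval x P := fun x => by
    rw [hp, eval_map, aeval_def]; rfl
  have evq : ∀ x, q.eval x = aeval x Q := fun x => by
    rw [hq, eval_map, aeval_def]; rfl
  have hs := IsAlgClosed.splits p
  have hdp : p.natDegree = P.natDegree := natDegree_map_intCast P
  have hdq : q.natDegree = Q.natDegree := natDegree_map_intCast Q
  -- The resultant is a nonzero integer, hence at least 1 in absolute value, and it is also a
  -- product of the values of `Q` at the roots of `P`.
  have hres : ((resultant P Q : ℤ) : ℂ) =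
      p.leadingCoeff ^ q.natDegree * (p.roots.map q.eval).prod := by
    rw [← resultant_eq_prod_eval p q _ le_rfl hs, hdp, hdq, hp, hq, resultant_map_map]
    rfl
  have hne : (resultant P Q : ℤ) ≠ 0 := by
    intro h0
    rw [h0, Int.cast_zero, eq_comm, mul_eq_zero] at hres
    rcases hres with h | h
    · exact leadingCoeff_ne_zero.2 hp0 (eq_zero_of_pow_eq_zero h)
    · rw [Multiset.prod_eq_zero_iff, Multiset.mem_map] at h
      obtain ⟨x, hx, hx'⟩ := h
      exact hPQ x (by rw [← evp]; exact (mem_roots hp0).1 hx) (by rw [← evq]; exact hx')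
  have h1 : (1 : ℝ) ≤ ‖((resultant P Q : ℤ) : ℂ)‖ := by
    rw [Complex.norm_intCast]
    exact_mod_cast Int.one_le_abs hne
  refine h1.trans ?_
  have hmem : α ∈ p.roots := (mem_roots hp0).2 (by rw [IsRoot, evp, hα])
  -- The factor at `α` supplies `‖α - β‖`; all other factors get the trivial bound.
  obtain ⟨t, ht⟩ := Multiset.exists_cons_of_mem hmem
  set K : ℝ := 2 ^ q.natDegree * q.mahlerMeasure with hK
  have hKn : 0 ≤ K := mul_nonneg (by positivity) (mahlerMeasure_nonneg _)
  have ht2 : ‖(t.map q.eval).prod‖ ≤ K ^ t.card * (t.map fun a => max 1 ‖a‖).prod ^ q.natDegree := by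
    clear ht
    induction t using Multiset.induction_on with
    | empty => simp
    | cons a s ih =>
      simp only [Multiset.map_cons, Multiset.prod_cons, Multiset.card_cons, norm_mul]
      calc _ ≤ (K * max 1 ‖a‖ ^ q.natDegree) * _ :=
            mul_le_mul (norm_eval_le q a) ih (norm_nonneg _) (by positivity)
        _ = _ := by ring
  have hall : ‖(p.roots.map q.eval).prod‖ ≤
      ‖α - β‖ * (K ^ p.roots.card * (p.roots.map fun a => max 1 ‖a‖).prod ^ q.natDegree) := by
    rw [ht]
    simp only [Multiset.map_cons, Multiset.prod_cons, Multiset.card_cons, norm_mul]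
    calc _ ≤ (‖α - β‖ * (K * max 1 ‖α‖ ^ q.natDegree)) * _ :=
          mul_le_mul (norm_eval_le_of_root q hq0 (by rw [evq, hβ]) α) ht2 (norm_nonneg _)
            (by positivity)
      _ = _ := by ring
  rw [hres, norm_mul, norm_pow]
  calc _ ≤ ‖p.leadingCoeff‖ ^ q.natDegree * _ := mul_le_mul_of_nonneg_left hall (by positivity)
    _ = ‖α - β‖ * (K ^ p.roots.card * (‖p.leadingCoeff‖ *
        (p.roots.map fun a => max 1 ‖a‖).prod) ^ q.natDegree) := by ring
    _ = _ := by
      rw [← mahlerMeasure_eq_leadingCoeff_mul_prod_roots, ← hs.natDegree_eq_card_roots, hK, hdp,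
        hdq, intMahler, intMahler, ← hp, ← hq]
      ring

/-! ### Elimination by resultants. -/

open Polynomial.Bivariate in
lemma eval₂_swap (G : ℤ[X][X]) (x : ℂ) :
    (Bivariate.swap G).eval₂ (mapRingHom (Int.castRingHom ℂ)) (C x) =
      G.map (aeval x : ℤ[X] →ₐ[ℤ] ℂ).toRingHom := by
  have h : (eval₂RingHom (mapRingHom (Int.castRingHom ℂ)) (C x)).comp
      (Bivariate.swap (R := ℤ)).toRingEquiv.toRingHom =
      mapRingHom (aeval x : ℤ[X] →ₐ[ℤ] ℂ).toRingHom := by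
    refine Polynomial.ringHom_ext' (Polynomial.ringHom_ext' (RingHom.ext_int _ _) ?_) ?_
    · simp [Bivariate.swap_X]
    · simp [Bivariate.swap_Y]
  exact congrArg (fun f => f G) h

lemma norm_aeval_le (P : ℤ[X]) (x : ℂ) :
    ‖aeval x P‖ ≤ 2 ^ P.natDegree * intMahler P * max 1 ‖x‖ ^ P.natDegree := by
  have h := norm_eval_le (P.map (Int.castRingHom ℂ)) x
  rw [natDegree_map_intCast, eval_map] at h
  exact h

/-- The Mahler measure is at most the sum of the norms of the coefficients, which are polynomials in
`x`. All `e' ≥ e` are allowed because the elimination needs an exponent no smaller than the degree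
of `G` in `x`. -/
lemma exists_mahlerMeasure_map_aeval_le (G : ℤ[X][X]) :
    ∃ (K : ℝ) (e : ℕ), 1 ≤ K ∧ ∀ e' : ℕ, e ≤ e' → ∀ x : ℂ,
      (G.map (aeval x : ℤ[X] →ₐ[ℤ] ℂ).toRingHom).mahlerMeasure ≤ K * max 1 ‖x‖ ^ e' := by
  refine ⟨1 + ∑ j ∈ Finset.range (G.natDegree + 1),
      2 ^ (G.coeff j).natDegree * intMahler (G.coeff j),
    ∑ j ∈ Finset.range (G.natDegree + 1), (G.coeff j).natDegree, ?_, fun e' he' x => ?_⟩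
  · rw [le_add_iff_nonneg_right]
    exact Finset.sum_nonneg fun j _ => mul_nonneg (by positivity) (mahlerMeasure_nonneg _)
  refine (mahlerMeasure_le_sum_norm_coeff _).trans ?_
  rw [sum_over_range' _ (by simp) (G.natDegree + 1)
    (Nat.lt_succ_of_le natDegree_map_le), add_mul, Finset.sum_mul]
  refine le_add_of_nonneg_of_le (by positivity) (Finset.sum_le_sum fun j hj => ?_)
  rw [coeff_map]
  refine (norm_aeval_le _ _).trans ?_
  have := mahlerMeasure_nonneg ((G.coeff j).map (Int.castRingHom ℂ))
  gcongr
  · exact le_max_left _ _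
  · exact (Finset.single_le_sum (f := fun j => (G.coeff j).natDegree)
      (fun _ _ => Nat.zero_le _) hj).trans he'

/-- Elimination: if `A(α) = 0` and `G(α, β) = 0`, then `β` is a root of an integer polynomial whose
degree and Mahler measure are controlled by those of `A`. -/
lemma exists_elimination (G : ℤ[X][X]) :
    ∃ (K : ℝ) (e : ℕ), 1 ≤ K ∧ ∀ A : ℤ[X], A ≠ 0 →
      (∀ x : ℂ, aeval x A = 0 → G.map (aeval x : ℤ[X] →ₐ[ℤ] ℂ).toRingHom ≠ 0) →
      ∃ B : ℤ[X], B ≠ 0 ∧ B.natDegree ≤ A.natDegree * G.natDegree ∧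
        intMahler B ≤ K ^ A.natDegree * intMahler A ^ e ∧
        ∀ α β : ℂ, aeval α A = 0 →
          (G.map (aeval α : ℤ[X] →ₐ[ℤ] ℂ).toRingHom).eval β = 0 → aeval β B = 0 := by
  obtain ⟨K, e₀, hK, hKe⟩ := exists_mahlerMeasure_map_aeval_le G
  set e := e₀ + (Bivariate.swap G).natDegree with he
  refine ⟨K, e, hK, fun A hA hG => ?_⟩
  set φ := mapRingHom (Int.castRingHom ℂ) with hφ
  set a := A.map (Int.castRingHom ℂ) with ha
  have ha0 : a ≠ 0 := map_intCast_ne_zero hA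
  have hda : a.natDegree = A.natDegree := natDegree_map_intCast A
  have hs := IsAlgClosed.splits a
  have eva : ∀ x, a.eval x = aeval x A := fun x => by
    rw [ha, eval_map, aeval_def]; rfl
  set g : ℂ → ℂ[X] := fun x => G.map (aeval x : ℤ[X] →ₐ[ℤ] ℂ).toRingHom with hg
  -- This is the resultant in `x` of `A(x)` and `G(x, Y)`. The formal degree `e` makes the power of
  -- the leading coefficient match the factors `max 1 ‖x‖ ^ e`, so that together they form
  -- `intMahler A ^ e`.
  set B := resultant (A.map C) (Bivariate.swap G) A.natDegree e with hB
  have hmap : (A.map C).map φ = a.map C := by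
    rw [ha, Polynomial.map_map, Polynomial.map_map]
    congr 1
    exact RingHom.ext_int _ _
  have hBφ : φ B = C a.leadingCoeff ^ e * (a.roots.map g).prod := by
    have h1 : (a.map C).Splits := hs.map _
    have h2 := resultant_eq_prod_eval (a.map C) ((Bivariate.swap G).map φ) e
      (natDegree_map_le.trans (Nat.le_add_left _ _)) h1
    rw [natDegree_map_eq_of_injective C_injective, hda, ← hmap, resultant_map_map, hmap,
      leadingCoeff_map_of_injective C_injective, hs.roots_map, Multiset.map_map] at h2
    rw [hB, h2]
    congr 3
    funext x
    simp only [Function.comp, hg]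
    rw [eval_map, eval₂_swap]
  have hroot : ∀ x ∈ a.roots, aeval x A = 0 := fun x hx => by
    rw [← eva]; exact (mem_roots ha0).1 hx
  have hφB : φ B ≠ 0 := by
    rw [hBφ]
    refine mul_ne_zero (pow_ne_zero _ (C_ne_zero.2 (leadingCoeff_ne_zero.2 ha0))) ?_
    rw [Ne, Multiset.prod_eq_zero_iff, Multiset.mem_map]
    rintro ⟨x, hx, hx'⟩
    exact hG x (hroot x hx) hx'
  have hB0 : B ≠ 0 := fun h => hφB (by rw [h, map_zero])
  refine ⟨B, hB0, ?_, ?_, fun α β hα hβ => ?_⟩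
  · have : B.natDegree = (φ B).natDegree := (natDegree_map_intCast B).symm
    rw [this, hBφ, ← C_pow]
    refine (natDegree_C_mul_le _ _).trans ?_
    refine (natDegree_multiset_prod_le _).trans ?_
    rw [← hda, hs.natDegree_eq_card_roots, Multiset.map_map, ← smul_eq_mul]
    have := Multiset.sum_le_card_nsmul (a.roots.map (natDegree ∘ g)) G.natDegree (by
      intro y hy
      obtain ⟨x, -, rfl⟩ := Multiset.mem_map.1 hy
      exact natDegree_map_le)
    simpa using this
  · have h1 : intMahler B = (φ B).mahlerMeasure := rfl
    rw [h1, hBφ, ← C_pow, mahlerMeasure_mul, mahlerMeasure_const,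
      prod_mahlerMeasure_eq_mahlerMeasure_prod, Multiset.map_map, intMahler, ← ha,
      mahlerMeasure_eq_leadingCoeff_mul_prod_roots, mul_pow, norm_pow, mul_left_comm, ← hda,
      hs.natDegree_eq_card_roots]
    refine mul_le_mul_of_nonneg_left ?_ (by positivity)
    generalize a.roots = s
    induction s using Multiset.induction_on with
    | empty => simp
    | cons x s ih =>
      simp only [Multiset.map_cons, Multiset.prod_cons, Multiset.card_cons, Function.comp_apply]
      calc _ ≤ (K * max 1 ‖x‖ ^ e) * _ :=
            mul_le_mul (hKe e (Nat.le_add_right _ _) x) ih (Multiset.prod_nonneg (by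
              intro y hy
              obtain ⟨x, -, rfl⟩ := Multiset.mem_map.1 hy
              exact mahlerMeasure_nonneg _)) (by positivity)
        _ = _ := by ring
  · have h1 : aeval β B = (φ B).eval β := by
      rw [hφ, coe_mapRingHom, eval_map, aeval_def]; rfl
    have hmem : α ∈ a.roots := (mem_roots ha0).2 (by rw [IsRoot, eva, hα])
    rw [h1, hBφ, eval_mul, eval_multiset_prod, Multiset.map_map]
    refine mul_eq_zero_of_right _ (Multiset.prod_eq_zero ?_)
    exact Multiset.mem_map.2 ⟨α, hmem, hβ⟩

/-! ### Algebraic coefficients and values at algebraic points. -/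

/-- The complex polynomials with algebraic coefficients. -/
def algPoly : Subring ℂ[X] := (mapRingHom (algebraMap Qbar ℂ)).range

lemma C_mem_algPoly {c : ℂ} (hc : IsAlgebraic ℚ c) : C c ∈ algPoly :=
  ⟨C ⟨c, mem_algebraicClosure_iff.2 hc⟩, by simp⟩

lemma X_mem_algPoly : (X : ℂ[X]) ∈ algPoly := ⟨X, by simp⟩

lemma map_intCast_mem_algPoly (P : ℤ[X]) : P.map (Int.castRingHom ℂ) ∈ algPoly :=
  ⟨P.map (Int.castRingHom Qbar), by
    rw [coe_mapRingHom, Polynomial.map_map]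
    congr 1⟩

lemma isAlgebraic_coeff {f : ℂ[X]} (hf : f ∈ algPoly) (i : ℕ) : IsAlgebraic ℚ (f.coeff i) := by
  obtain ⟨g, rfl⟩ := hf
  rw [coe_mapRingHom, coeff_map]
  exact mem_algebraicClosure_iff.1 (g.coeff i).2

lemma mem_algPoly_of_coeff {f : ℂ[X]} (hf : ∀ i, IsAlgebraic ℚ (f.coeff i)) : f ∈ algPoly := by
  rw [f.as_sum_range_C_mul_X_pow]
  exact sum_mem fun i _ => mul_mem (C_mem_algPoly (hf i)) (pow_mem X_mem_algPoly i)

lemma isAlgebraic_eval {f : ℂ[X]} (hf : f ∈ algPoly) {x : ℂ} (hx : IsAlgebraic ℚ x) :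
    IsAlgebraic ℚ (f.eval x) := by
  have hx' := mem_algebraicClosure_iff.2 hx
  rw [← mem_algebraicClosure_iff, eval_eq_sum_range]
  exact sum_mem fun i _ => mul_mem (mem_algebraicClosure_iff.2 (isAlgebraic_coeff hf i))
    (pow_mem hx' i)

/-- `Qbar` is algebraic over `ℚ`, so `ξ` is transcendental over `Qbar` as well. This transfers
identities from the single point `ξ` to all points. -/
lemma eq_zero_of_eval_transcendental {ξ : ℂ} (hξ : Transcendental ℚ ξ) {f : ℂ[X]}
    (hf : f ∈ algPoly) (h : f.eval ξ = 0) : f = 0 := by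
  obtain ⟨g, rfl⟩ := hf
  by_contra hg
  have hg0 : g ≠ 0 := fun h0 => hg (by rw [h0, map_zero])
  have : Algebra.IsAlgebraic ℚ Qbar := algebraicClosure.isAlgebraic ℚ ℂ
  refine hξ (IsAlgebraic.restrictScalars ℚ (S := Qbar) ⟨g, hg0, ?_⟩)
  rwa [coe_mapRingHom, eval_map] at h

lemma mem_algPoly_conj {f : ℂ[X]} (hf : f ∈ algPoly) : f.map (starRingEnd ℂ) ∈ algPoly := by
  refine mem_algPoly_of_coeff fun i => ?_
  rw [coeff_map]
  obtain ⟨P, hP0, hP⟩ := isAlgebraic_coeff hf i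
  refine ⟨P, hP0, ?_⟩
  have h2 : starRingEnd ℂ (aeval (f.coeff i) P) =
      eval₂ ((starRingEnd ℂ).comp (algebraMap ℚ ℂ)) (starRingEnd ℂ (f.coeff i)) P := by
    rw [aeval_def, hom_eval₂]
  rw [hP, map_zero, Subsingleton.elim ((starRingEnd ℂ).comp (algebraMap ℚ ℂ))
    (algebraMap ℚ ℂ)] at h2
  exact h2.symm

/-- A rational function that is real at a real transcendental point is real on the real line. -/
lemma im_div_eq_zero {p q : ℂ[X]} (hp : p ∈ algPoly) (hq : q ∈ algPoly) {ξ : ℂ}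
    (hξ : Transcendental ℚ ξ) (hξr : ξ.im = 0) (hqξ : q.eval ξ ≠ 0)
    (hz : (p.eval ξ / q.eval ξ).im = 0) {α : ℂ} (hα : α.im = 0) :
    (p.eval α / q.eval α).im = 0 := by
  have conj_eval : ∀ (f : ℂ[X]) {x : ℂ}, x.im = 0 →
      (f.map (starRingEnd ℂ)).eval x = starRingEnd ℂ (f.eval x) := fun f x hx => by
    conv_lhs => rw [← Complex.conj_eq_iff_im.2 hx]
    rw [eval_map, eval₂_at_apply]
  -- The numerator of the difference between the rational function and its conjugate; it vanishes at
  -- `ξ`, hence identically.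
  set r := p * q.map (starRingEnd ℂ) - p.map (starRingEnd ℂ) * q with hr
  have hrm : r ∈ algPoly :=
    sub_mem (mul_mem hp (mem_algPoly_conj hq)) (mul_mem (mem_algPoly_conj hp) hq)
  have hc := Complex.conj_eq_iff_im.2 hz
  have hq' : starRingEnd ℂ (q.eval ξ) ≠ 0 := fun h => hqξ (by simpa using h)
  have hr0 : r = 0 := by
    refine eq_zero_of_eval_transcendental hξ hrm ?_
    rw [hr, eval_sub, eval_mul, eval_mul, conj_eval q hξr, conj_eval p hξr]
    rw [map_div₀, div_eq_div_iff hq' hqξ] at hc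
    rw [hc, sub_self]
  have hα2 := congrArg (eval α) hr0
  rw [hr, eval_sub, eval_mul, eval_mul, conj_eval q hα, conj_eval p hα, eval_zero,
    sub_eq_zero] at hα2
  -- At a zero of `q` the quotient is 0 by convention.
  by_cases hqα : q.eval α = 0
  · simp [hqα]
  have hqα' : starRingEnd ℂ (q.eval α) ≠ 0 := fun h => hqα (by simpa using h)
  rw [← Complex.conj_eq_iff_im, map_div₀, div_eq_div_iff hqα' hqα, hα2]

/-- View `ℂ` as a `ℤ[X]`-algebra through `X ↦ ξ`, faithful because `ξ` is transcendental. Then `ξ`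
and all algebraic numbers are algebraic over `ℤ[X]`, hence so is the quotient. -/
lemma exists_algebraic_relation {p q : ℂ[X]} (hp : p ∈ algPoly) (hq : q ∈ algPoly) {ξ : ℂ}
    (hξ : Transcendental ℚ ξ) :
    ∃ G : ℤ[X][X], G ≠ 0 ∧
      (G.map (aeval ξ : ℤ[X] →ₐ[ℤ] ℂ).toRingHom).eval (p.eval ξ / q.eval ξ) = 0 := by
  let : Algebra ℤ[X] ℂ := (aeval ξ : ℤ[X] →ₐ[ℤ] ℂ).toRingHom.toAlgebra
  have hinj : Function.Injective (algebraMap ℤ[X] ℂ) := by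
    have h1 : Transcendental ℤ ξ := hξ.restrictScalars (algebraMap ℤ ℚ).injective_int
    exact transcendental_iff_injective.1 h1
  have : FaithfulSMul ℤ[X] ℂ := (faithfulSMul_iff_algebraMap_injective _ _).2 hinj
  have : IsScalarTower ℤ ℤ[X] ℂ := IsScalarTower.of_algebraMap_eq' (RingHom.ext_int _ _)
  have hev : ∀ f ∈ algPoly, IsAlgebraic ℤ[X] (f.eval ξ) := by
    intro f hf
    rw [eval_eq_sum_range]
    have hX : IsAlgebraic ℤ[X] ξ := by
      have h1 : algebraMap ℤ[X] ℂ X = ξ := aeval_X ξ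
      rw [← h1]
      exact isAlgebraic_algebraMap _
    refine sum_mem (S := Subalgebra.algebraicClosure ℤ[X] ℂ) fun i _ => ?_
    refine mul_mem ?_ (pow_mem hX i)
    have h1 : IsAlgebraic ℤ (f.coeff i) :=
      (IsFractionRing.isAlgebraic_iff ℤ ℚ ℂ).2 (isAlgebraic_coeff hf i)
    exact h1.extendScalars (C_injective)
  have hz : IsAlgebraic ℤ[X] (p.eval ξ / q.eval ξ) := by
    rw [div_eq_mul_inv]
    exact (hev p hp).mul (hev q hq).inv
  obtain ⟨G, hG0, hG⟩ := hz
  refine ⟨G, hG0, ?_⟩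
  rw [eval_map]
  exact hG

/-- Multiplying the relation by `q ^ G.natDegree` gives a polynomial with algebraic coefficients
that vanishes at `ξ`, so it is zero. -/
lemma eval_relation {p q : ℂ[X]} (hp : p ∈ algPoly) (hq : q ∈ algPoly) {ξ : ℂ}
    (hξ : Transcendental ℚ ξ) (hqξ : q.eval ξ ≠ 0) {G : ℤ[X][X]}
    (hG : (G.map (aeval ξ : ℤ[X] →ₐ[ℤ] ℂ).toRingHom).eval (p.eval ξ / q.eval ξ) = 0)
    {α : ℂ} (hα : q.eval α ≠ 0) :
    (G.map (aeval α : ℤ[X] →ₐ[ℤ] ℂ).toRingHom).eval (p.eval α / q.eval α) = 0 := by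
  set h : ℂ[X] := ∑ j ∈ Finset.range (G.natDegree + 1),
    (G.coeff j).map (Int.castRingHom ℂ) * p ^ j * q ^ (G.natDegree - j) with hh
  have hmem : h ∈ algPoly := sum_mem fun j _ =>
    mul_mem (mul_mem (map_intCast_mem_algPoly _) (pow_mem hp _)) (pow_mem hq _)
  have key : ∀ x : ℂ, q.eval x ≠ 0 → h.eval x = q.eval x ^ G.natDegree *
      (G.map (aeval x : ℤ[X] →ₐ[ℤ] ℂ).toRingHom).eval (p.eval x / q.eval x) := by
    intro x hx
    rw [eval_eq_sum_range' (Nat.lt_succ_of_le natDegree_map_le), hh, eval_finsetSum,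
      Finset.mul_sum]
    refine Finset.sum_congr rfl fun j hj => ?_
    have hj' : j ≤ G.natDegree := Nat.lt_succ_iff.1 (Finset.mem_range.1 hj)
    have h1 : ((G.coeff j).map (Int.castRingHom ℂ)).eval x = aeval x (G.coeff j) := by
      rw [eval_map, aeval_def]; rfl
    rw [eval_mul, eval_mul, eval_pow, eval_pow, h1, coeff_map, div_pow,
      ← Nat.sub_add_cancel hj', pow_add, Nat.sub_add_cancel hj']
    change aeval x (G.coeff j) * _ * _ = _ * (aeval x (G.coeff j) * _)
    field_simp
  have h0 : h = 0 := eq_zero_of_eval_transcendental hξ hmem (by rw [key ξ hqξ, hG, mul_zero])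
  have h1 := key α hα
  rw [h0, eval_zero, eq_comm, mul_eq_zero] at h1
  exact h1.resolve_left (pow_ne_zero _ hα)

/-- Degree and height of the values of a rational function at algebraic numbers. -/
lemma exists_height_div_le {p q : ℂ[X]} (hp : p ∈ algPoly) (hq : q ∈ algPoly) {ξ : ℂ}
    (hξ : Transcendental ℚ ξ) (hqξ : q.eval ξ ≠ 0) (m : ℕ) :
    ∃ (K : ℝ) (e D : ℕ) (E : Set ℂ), 1 ≤ K ∧ E.Finite ∧ ∀ α : ℂ, IsAlgebraic ℚ α →
      (minpoly ℚ α).natDegree = m → α ∉ E →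
        q.eval α ≠ 0 ∧ IsAlgebraic ℚ (p.eval α / q.eval α) ∧
        (minpoly ℚ (p.eval α / q.eval α)).natDegree ≤ D ∧
        height (p.eval α / q.eval α) ≤ K * height α ^ e := by
  obtain ⟨G, hG0, hG⟩ := exists_algebraic_relation hp hq hξ
  obtain ⟨K, e, hK, hel⟩ := exists_elimination G
  have hlc : G.leadingCoeff ≠ 0 := leadingCoeff_ne_zero.2 hG0
  have hq0 : q ≠ 0 := fun h => hqξ (by rw [h, eval_zero])
  refine ⟨2 ^ (m * G.natDegree) * (K ^ m * (m + 1) ^ e), e, m * G.natDegree,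
    {x | q.eval x = 0} ∪ {x | aeval x G.leadingCoeff = 0}, ?_, ?_, fun α hα hm hE => ?_⟩
  · exact one_le_mul_of_one_le_of_one_le (one_le_pow₀ one_le_two)
      (one_le_mul_of_one_le_of_one_le (one_le_pow₀ hK) (one_le_pow₀ (by simp)))
  · refine Set.Finite.union ?_ ?_
    · exact q.finite_setOfPred_isRoot hq0
    · refine (G.leadingCoeff.rootSet_finite ℂ).subset fun x hx => ?_
      exact (mem_rootSet_of_ne hlc).2 hx
  simp only [Set.mem_union, Set.mem_ofPred_eq, not_or] at hE
  obtain ⟨hqα, hgα⟩ := hE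
  have halg : IsAlgebraic ℚ (p.eval α / q.eval α) := by
    rw [div_eq_mul_inv]
    exact (isAlgebraic_eval hp hα).mul (isAlgebraic_eval hq hα).inv
  -- Elimination needs `G(x, Y) ≠ 0` at every conjugate `x` of `α`. If the leading coefficient of
  -- `G` vanished at one conjugate, it would vanish at `α`, which lies outside the exceptional set.
  obtain ⟨B, hB0, hBd, hBM, hB⟩ := hel (intMinpoly α) intMinpoly_ne_zero (by
    intro x hx h0
    have h1 : aeval x G.leadingCoeff = 0 := by
      have := congrArg (fun f => coeff f G.natDegree) h0
      rw [coeff_map, coeff_zero] at this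
      exact this
    have h2 : minpoly ℚ x ∣ G.leadingCoeff.map (algebraMap ℤ ℚ) := by
      apply minpoly.dvd
      rwa [aeval_map_algebraMap]
    rw [← minpoly_eq_of_aeval_intMinpoly hα hx] at h2
    apply hgα
    rw [← aeval_map_algebraMap ℚ α]
    exact aeval_eq_zero_of_dvd_aeval_eq_zero h2 (minpoly.aeval _ _))
  have hroot := hB α _ (aeval_intMinpoly hα) (eval_relation hp hq hξ hqξ hG hqα)
  have hdeg : (intMinpoly α).natDegree = m := (natDegree_intMinpoly hα).trans hm
  rw [hdeg] at hBd hBM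
  refine ⟨hqα, halg, (natDegree_minpoly_le halg hB0 hroot).trans hBd, ?_⟩
  have hM := intMahler_intMinpoly_le_height hα
  rw [hm] at hM
  calc _ ≤ 2 ^ B.natDegree * intMahler B := height_le halg hB0 hroot
    _ ≤ 2 ^ (m * G.natDegree) * (K ^ m * ((m + 1) * height α) ^ e) := by
      have : 0 ≤ intMahler (intMinpoly α) := mahlerMeasure_nonneg _
      gcongr
      · exact mahlerMeasure_nonneg _
      · exact one_le_two
      · exact hBM.trans (by gcongr)
    _ = _ := by rw [mul_pow]; ring

lemma exists_lipschitz (p q : ℂ[X]) {ξ : ℂ} (hqξ : q.eval ξ ≠ 0) :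
    ∃ C δ : ℝ, 1 ≤ C ∧ 0 < δ ∧ ∀ x : ℂ, ‖ξ - x‖ < δ →
      ‖p.eval ξ / q.eval ξ - p.eval x / q.eval x‖ ≤ C * ‖ξ - x‖ := by
  have hd : DifferentiableAt ℂ (fun x => p.eval x / q.eval x) ξ :=
    p.differentiableAt.div q.differentiableAt hqξ
  obtain ⟨C, hC, hO⟩ := hd.isBigO_sub.exists_pos
  obtain ⟨δ, hδ, h⟩ := Metric.eventually_nhds_iff.1 hO.bound
  refine ⟨max 1 C, δ, le_max_left _ _, hδ, fun x hx => ?_⟩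
  have h1 := h (y := x) (by rwa [dist_comm, dist_eq_norm])
  rw [norm_sub_rev, norm_sub_rev ξ x]
  exact h1.trans (by gcongr; exact le_max_right _ _)

/-! ### Criteria for Koksma's exponent to be infinite or finite. -/

lemma approximants_subset {n : ℕ} {z : ℂ} {w w' : ℝ} (h : w ≤ w') :
    approximants n w' z ⊆ approximants n w z := by
  rintro α ⟨h1, h2, h3, h4, h5⟩
  exact ⟨h1, h2, h3, h4,
    h5.trans_le (Real.rpow_le_rpow_of_exponent_le (one_le_height α) (by linarith))⟩

lemma omegaStar_eq_top_iff {n : ℕ} {z : ℂ} :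
    omegaStar n z = ⊤ ↔ ∀ w : ℝ, 0 < w → (approximants n w z).Infinite := by
  constructor
  · intro h w hw hfin
    have hle : omegaStar n z ≤ ENNReal.ofReal w := by
      refine iSup₂_le fun w' hw' => ENNReal.ofReal_le_ofReal ?_
      by_contra! hlt
      exact hw'.2 (hfin.subset (approximants_subset hlt.le))
    rw [h, top_le_iff] at hle
    exact ENNReal.ofReal_ne_top hle
  · intro h
    refine ENNReal.eq_top_of_forall_nnreal_le fun r => ?_
    have hr : (0 : ℝ) < r + 1 := by positivity
    refine le_trans ?_ (le_iSup₂ (f := fun (w : ℝ)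
      (_ : 0 < w ∧ (approximants n w z).Infinite) => ENNReal.ofReal w) ((r : ℝ) + 1) ⟨hr, h _ hr⟩)
    rw [← ENNReal.ofReal_coe_nnreal]
    exact ENNReal.ofReal_le_ofReal (by linarith)

lemma infinite_height_gt {n : ℕ} {w : ℝ} {z : ℂ} (h : (approximants n w z).Infinite) (B : ℝ) :
    {α ∈ approximants n w z | B < height α}.Infinite := by
  refine (h.sdiff (finite_height_le n B)).mono fun α hα => ⟨hα.1, ?_⟩
  by_contra! hle
  exact hα.2 ⟨hα.1.1, hα.1.2.1, hle⟩

/-- An approximation of order `k + 1` would give `H ^ 2 ≤ max C 0`, which fails once `H > max C 0`;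
by Northcott such heights occur among infinitely many approximants. -/
lemma omegaStar_lt_top {n k : ℕ} {z : ℂ} {C : ℝ} {E : Set ℂ} (hE : E.Finite)
    (h : ∀ α : ℂ, IsAlgebraic ℚ α → (minpoly ℚ α).natDegree = n → α ∉ E →
      1 ≤ ‖z - α‖ * (C * height α ^ k)) : omegaStar n z < ⊤ := by
  rw [lt_top_iff_ne_top]
  intro htop
  have hinf := infinite_height_gt
    (omegaStar_eq_top_iff.1 htop ((k : ℝ) + 1) (by positivity)) (max C 0)
  obtain ⟨α, ⟨⟨h1, h2, h3, h4, h5⟩, hC⟩, hαE⟩ := (hinf.sdiff hE).nonempty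
  have hH := height_pos α
  have hH1 := one_le_height α
  have hC0 : 0 ≤ max C 0 := le_max_right _ _
  have h6 := h α h1 h2 hαE
  generalize height α = H at h5 hC hH hH1 h6
  have h7 : ‖z - α‖ * (C * H ^ k) ≤ ‖z - α‖ * (max C 0 * H ^ k) := by
    gcongr
    exact le_max_left _ _
  have h8 : ‖z - α‖ * (max C 0 * H ^ k) ≤
      H ^ (-((k : ℝ) + 1) - 1) * (max C 0 * H ^ k) := by gcongr
  have h9 : H ^ (-((k : ℝ) + 1) - 1) * (max C 0 * H ^ k) =
      max C 0 / H ^ 2 := by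
    rw [show (-((k : ℝ) + 1) - 1) = -(((k + 2 : ℕ)) : ℝ) by push_cast; ring,
      Real.rpow_neg hH.le, Real.rpow_natCast, pow_add]
    field_simp
  have h10 : 1 ≤ max C 0 / H ^ 2 := by linarith
  rw [le_div_iff₀ (by positivity)] at h10
  nlinarith [hH1]

/-- Liouville's inequality in terms of heights; minimal polynomials with a common root coincide. -/
lemma one_le_of_minpoly_ne {α β : ℂ} (hα : IsAlgebraic ℚ α) (hβ : IsAlgebraic ℚ β)
    (hne : minpoly ℚ α ≠ minpoly ℚ β) {m n : ℕ} (hm : (minpoly ℚ α).natDegree = m)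
    (hn : (minpoly ℚ β).natDegree = n) :
    1 ≤ ‖α - β‖ * (2 ^ (m * n) * ((n + 1) * height β) ^ m * ((m + 1) * height α) ^ n) := by
  have h := one_le_of_no_common_root intMinpoly_ne_zero intMinpoly_ne_zero
    (fun x hx hx' => hne ((minpoly_eq_of_aeval_intMinpoly hα hx).trans
      (minpoly_eq_of_aeval_intMinpoly hβ hx').symm)) (aeval_intMinpoly hα) (aeval_intMinpoly hβ)
  rw [natDegree_intMinpoly hα, natDegree_intMinpoly hβ, hm, hn] at h
  have h1 := intMahler_intMinpoly_le_height hα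
  have h2 := intMahler_intMinpoly_le_height hβ
  rw [hm] at h1
  rw [hn] at h2
  have h3 : 0 ≤ intMahler (intMinpoly α) := mahlerMeasure_nonneg _
  have h4 : 0 ≤ intMahler (intMinpoly β) := mahlerMeasure_nonneg _
  have h5 := height_pos β
  generalize height α = a at h1
  generalize height β = b at h2 h5
  refine h.trans ?_
  gcongr

lemma omegaStar_lt_top_of_isAlgebraic {z : ℂ} (hz : IsAlgebraic ℚ z) (n : ℕ) :
    omegaStar n z < ⊤ := by
  set d := (minpoly ℚ z).natDegree with hd
  refine omegaStar_lt_top (k := d)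
    (C := 2 ^ (d * n) * (n + 1) ^ d * ((d + 1) * height z) ^ n)
    ((intMinpoly z).rootSet_finite ℂ) fun α hα hn hE => ?_
  have h := one_le_of_minpoly_ne hz hα (fun he => hE ?_) hd.symm hn
  · convert h using 2
    rw [mul_pow _ (height α)]
    ring
  · rw [mem_rootSet_of_ne intMinpoly_ne_zero, aeval_intMinpoly_eq_zero_iff hz, he]
    exact minpoly.aeval _ _

/-! ### `U`-numbers and their images under rational functions. -/

lemma IsUNumber.transcendental {m : ℕ} {z : ℂ} (h : IsUNumber m z) : Transcendental ℚ z :=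
  fun hz => (omegaStar_lt_top_of_isAlgebraic hz m).ne h.2.1

lemma IsUNumber.unique {m n : ℕ} {z : ℂ} (hm : IsUNumber m z) (hn : IsUNumber n z) : m = n := by
  rcases lt_trichotomy m n with h | h | h
  · exact absurd hm.2.1 (hn.2.2 m hm.1 h).ne
  · exact h
  · exact absurd hn.2.1 (hm.2.2 n hn.1 h).ne

lemma exists_isUNumber {n : ℕ} {z : ℂ} (hn : 1 ≤ n) (h : omegaStar n z = ⊤) :
    ∃ s, IsUNumber s z := by
  classical
  have hex : ∃ n, 1 ≤ n ∧ omegaStar n z = ⊤ := ⟨n, hn, h⟩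
  refine ⟨Nat.find hex, (Nat.find_spec hex).1, (Nat.find_spec hex).2, fun k hk hlt => ?_⟩
  exact lt_top_iff_ne_top.2 fun htop => Nat.find_min hex hlt ⟨hk, htop⟩

/-- The fibre over `c ≠ z` consists of roots of `p - c * q`, which is nonzero because it does not
vanish at `ξ`. So fibres are finite. -/
lemma infinite_image_div {p q : ℂ[X]} {z : ℂ} {S : Set ℂ} (hS : S.Infinite)
    {ξ : ℂ} (hqξ : q.eval ξ ≠ 0) (hz : p.eval ξ / q.eval ξ = z)
    (hne : ∀ α ∈ S, q.eval α ≠ 0 ∧ p.eval α / q.eval α ≠ z) :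
    ((fun α => p.eval α / q.eval α) '' S).Infinite := by
  intro hfin
  refine hS ((hfin.biUnion (t := fun c => {x | c ≠ z ∧ (p - C c * q).eval x = 0})
    fun c _ => ?_).subset fun α hα => ?_)
  · by_cases hc : c = z
    · simp [hc]
    · refine (finite_setOfPred_isRoot (p := p - C c * q) fun h0 => hc ?_).subset fun x hx => hx.2
      have := congrArg (eval ξ) h0
      rw [eval_sub, eval_mul, eval_C, eval_zero, sub_eq_zero] at this
      rw [← hz, this, mul_div_cancel_right₀ _ hqξ]
  · simp only [Set.mem_iUnion]
    obtain ⟨h1, h2⟩ := hne α hα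
    refine ⟨_, ⟨α, hα, rfl⟩, h2, ?_⟩
    simp only [eval_sub, eval_mul, eval_C]
    rw [div_mul_cancel₀ _ h1, sub_self]

/-- A nonconstant rational function with algebraic coefficients maps real `U`-numbers to
`U`-numbers. -/
lemma IsUNumber.div {m : ℕ} {ξ : ℂ} (hξ : IsUNumber m ξ) (hξr : ξ.im = 0) {p q : ℂ[X]}
    (hp : p ∈ algPoly) (hq : q ∈ algPoly) (hqξ : q.eval ξ ≠ 0)
    (hz : Transcendental ℚ (p.eval ξ / q.eval ξ)) :
    ∃ s, IsUNumber s (p.eval ξ / q.eval ξ) := by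
  have hξt := hξ.transcendental
  obtain ⟨K, e, D, E, hK, hE, hF⟩ := exists_height_div_le hp hq hξt hqξ m
  obtain ⟨C, δ, hC, hδ, hlip⟩ := exists_lipschitz p q hqξ
  set z := p.eval ξ / q.eval ξ with hzdef
  have hinf := omegaStar_eq_top_iff.1 hξ.2.1
  have key : ∀ w : ℝ, 0 < w → ∃ n ∈ Finset.Icc 1 D, (approximants n w z).Infinite := by
    intro w hw
    -- Order `e * (w + 1)` pays for the height growth `H ^ e`; `e + 1` keeps the order positive when
    -- `e = 0`. The extra `-1` in the exponent absorbs `C * K ^ (w + 1)` once `H` is large, and `H >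
    -- δ⁻¹` puts `α` in the Lipschitz neighbourhood.
    have hW : 0 < ((e : ℝ) + 1) * (w + 1) := by positivity
    set S := {α ∈ approximants m (((e : ℝ) + 1) * (w + 1)) ξ |
      max (C * K ^ (w + 1)) δ⁻¹ < height α} \ E with hS
    have hSinf : S.Infinite := (infinite_height_gt (hinf _ hW) _).sdiff hE
    have himg : ((fun α => p.eval α / q.eval α) '' S).Infinite := by
      refine infinite_image_div hSinf hqξ rfl fun α hα => ?_
      obtain ⟨h1, h2, -, -⟩ := hF α hα.1.1.1 hα.1.1.2.1 hα.2
      exact ⟨h1, fun h => hz (by rwa [h] at h2)⟩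
    have hsub : ((fun α => p.eval α / q.eval α) '' S) ⊆
        ⋃ n ∈ Finset.Icc 1 D, approximants n w z := by
      rintro _ ⟨α, hα, rfl⟩
      obtain ⟨⟨⟨h1, h2, h3, h4, h5⟩, hH⟩, hαE⟩ := hα
      obtain ⟨g1, g2, g3, g4⟩ := hF α h1 h2 hαE
      simp only [Set.mem_iUnion]
      refine ⟨_, Finset.mem_Icc.2 ⟨minpoly.natDegree_pos g2.isIntegral, g3⟩, g2, rfl,
        fun hzr => im_div_eq_zero hp hq hξt hξr hqξ hzr (h3 hξr), ?_, ?_⟩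
      · rw [norm_pos_iff, sub_ne_zero]
        intro h
        exact hz (by rwa [← h] at g2)
      have hHp := height_pos α
      have hH1 := one_le_height α
      have hFp := height_pos (p.eval α / q.eval α)
      generalize height α = H at h5 hH g4 hHp hH1
      generalize height (p.eval α / q.eval α) = H' at g4 hFp
      have hHδ : (H)⁻¹ < δ := by
        rw [inv_lt_comm₀ hHp hδ]
        exact (le_max_right _ _).trans_lt hH
      have h6 : H ^ (-(((e : ℝ) + 1) * (w + 1)) - 1) ≤ (H)⁻¹ := by
        rw [← Real.rpow_neg_one]
        exact Real.rpow_le_rpow_of_exponent_le hH1 (by linarith)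
      have hKp : 0 < K := by linarith
      calc ‖z - p.eval α / q.eval α‖ ≤ C * ‖ξ - α‖ := hlip α ((h5.trans_le h6).trans hHδ)
        _ ≤ C * H ^ (-(((e : ℝ) + 1) * (w + 1)) - 1) := by gcongr
        _ = (C * (H)⁻¹) * H ^ (-(((e : ℝ) + 1) * (w + 1))) := by
          rw [Real.rpow_sub_one hHp.ne']; ring
        _ < (K ^ (w + 1))⁻¹ * H ^ (-(((e : ℝ) + 1) * (w + 1))) := by
          refine mul_lt_mul_of_pos_right ?_ (by positivity)
          rw [← div_eq_mul_inv, div_lt_iff₀ hHp, inv_mul_eq_div, lt_div_iff₀ (by positivity)]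
          exact (le_max_left _ _).trans_lt hH
        _ ≤ (K ^ (w + 1))⁻¹ * H ^ (-((e : ℝ) * (w + 1))) := by
          refine mul_le_mul_of_nonneg_left ?_ (by positivity)
          refine Real.rpow_le_rpow_of_exponent_le hH1 ?_
          nlinarith
        _ = (K * H ^ e) ^ (-w - 1) := by
          rw [Real.mul_rpow hKp.le (by positivity), ← Real.rpow_natCast (H) e,
            ← Real.rpow_mul hHp.le, ← Real.rpow_neg hKp.le]
          congr 2 <;> ring
        _ ≤ _ := Real.rpow_le_rpow_of_nonpos hFp g4 (by linarith)
    by_contra! hno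
    exact himg ((Set.Finite.biUnion (Finset.finite_toSet _) fun n hn =>
      hno n hn).subset hsub)
  by_contra! hno
  -- The degree found in `key` depends on `w`. If every degree failed at some `f n`, all degrees up
  -- to `D` would fail at any order above the sum of the `f n`.
  have hfin : ∀ n : ℕ, ∃ w : ℝ, 0 < w ∧ (1 ≤ n → ¬ (approximants n w z).Infinite) := by
    intro n
    by_cases hn : 1 ≤ n
    · have : ¬ omegaStar n z = ⊤ := fun h => by
        obtain ⟨s, hs⟩ := exists_isUNumber hn h
        exact hno s hs
      rw [omegaStar_eq_top_iff] at this
      push Not at this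
      obtain ⟨w, hw, h⟩ := this
      exact ⟨w, hw, fun _ => Set.not_infinite.2 h⟩
    · exact ⟨1, one_pos, fun h => absurd h hn⟩
  choose f hf0 hf using hfin
  obtain ⟨n, hn, hninf⟩ := key (1 + ∑ i ∈ Finset.Icc 1 D, f i)
    (add_pos_of_pos_of_nonneg one_pos (Finset.sum_nonneg fun i _ => (hf0 i).le))
  refine hf n (Finset.mem_Icc.1 hn).1 (hninf.mono (approximants_subset ?_))
  have := Finset.single_le_sum (f := f) (fun i _ => (hf0 i).le) hn
  linarith

/-! ### The Liouville constant and its partial sums. -/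

/-- The partial sums `∑_{1 ≤ n ≤ k} 10 ^ (-n!)` of the Liouville constant. -/
def liouvillePartial (k : ℕ) : ℝ := LiouvilleNumber.partialSum 10 k - 1 / 10

/-- `liouvilleNumber` starts at `n = 0`, whose term is `10 ^ (-0!) = 1 / 10`. -/
lemma liouvilleConstant_eq : liouvilleConstant = liouvilleNumber 10 - 1 / 10 := by
  have h := (LiouvilleNumber.summable (m := 10) (by norm_num)).tsum_eq_zero_add
  rw [liouvilleNumber, h, liouvilleConstant]
  simp [Nat.factorial]

lemma liouvilleConstant_sub (k : ℕ) :
    liouvilleConstant - liouvillePartial k = LiouvilleNumber.remainder 10 k := by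
  rw [liouvilleConstant_eq, liouvillePartial,
    ← LiouvilleNumber.partialSum_add_remainder (by norm_num) k]
  ring

lemma liouvillePartial_lt (k : ℕ) : liouvillePartial k < liouvilleConstant := by
  have := LiouvilleNumber.remainder_pos (m := 10) (by norm_num) k
  rw [← liouvilleConstant_sub] at this
  linarith

lemma liouvillePartial_strictMono : StrictMono liouvillePartial := by
  refine strictMono_nat_of_lt_succ fun k => ?_
  rw [liouvillePartial, liouvillePartial, LiouvilleNumber.partialSum_succ]
  have : (0 : ℝ) < 1 / 10 ^ (k + 1).factorial := by positivity
  linarith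

lemma liouvillePartial_zero : liouvillePartial 0 = 0 := by
  simp [liouvillePartial, LiouvilleNumber.partialSum]

lemma liouvillePartial_pos {k : ℕ} (hk : 1 ≤ k) : 0 < liouvillePartial k := by
  rw [← liouvillePartial_zero]
  exact liouvillePartial_strictMono hk

lemma liouvilleConstant_pos : 0 < liouvilleConstant := by
  rw [← liouvillePartial_zero]
  exact liouvillePartial_lt 0

lemma liouvilleConstant_le_one : liouvilleConstant ≤ 1 := by
  have h := LiouvilleNumber.remainder_lt (m := 10) 1 (by norm_num)
  rw [← liouvilleConstant_sub] at h
  have h1 : liouvillePartial 1 = 1 / 10 := by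
    simp [liouvillePartial, LiouvilleNumber.partialSum, Finset.sum_range_succ]
  rw [h1] at h
  norm_num at h
  linarith

lemma norm_liouvilleConstant_sub_le (k : ℕ) :
    ‖(liouvilleConstant : ℂ) - (liouvillePartial k : ℂ)‖ ≤ 1 / ((10 : ℝ) ^ k.factorial) ^ k := by
  rw [← Complex.ofReal_sub, Complex.norm_real, liouvilleConstant_sub, Real.norm_eq_abs,
    abs_of_pos (LiouvilleNumber.remainder_pos (by norm_num) k)]
  exact (LiouvilleNumber.remainder_lt k (by norm_num)).le

lemma transcendental_liouvilleConstant : Transcendental ℚ (liouvilleConstant : ℂ) := by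
  intro h
  have h1 : IsAlgebraic ℚ liouvilleConstant :=
    (isAlgebraic_algebraMap_iff (R := ℚ) (A := ℂ) (a := liouvilleConstant)
      Complex.ofReal_injective).1 h
  have h2 : IsAlgebraic ℚ (liouvilleNumber ((10 : ℕ) : ℝ)) := by
    have h3 : liouvilleNumber ((10 : ℕ) : ℝ) = liouvilleConstant + algebraMap ℚ ℝ (1 / 10) := by
      rw [liouvilleConstant_eq]
      norm_num
    rw [h3]
    exact h1.add (isAlgebraic_algebraMap _)
  exact transcendental_liouvilleNumber (m := 10) (by norm_num)
    ((IsFractionRing.isAlgebraic_iff ℤ ℚ ℝ).2 h2)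

lemma exists_int_liouvillePartial (k : ℕ) :
    ∃ a : ℤ, liouvillePartial k * (10 * 10 ^ k.factorial) = a := by
  obtain ⟨p, hp⟩ := LiouvilleNumber.partialSum_eq_rat (m := 10) (by norm_num) k
  refine ⟨10 * p - 10 ^ k.factorial, ?_⟩
  push_cast at hp
  rw [liouvillePartial, hp]
  push_cast
  field_simp

lemma exists_rat_liouvillePartial (k : ℕ) : ∃ r : ℚ, (r : ℝ) = liouvillePartial k := by
  obtain ⟨a, ha⟩ := exists_int_liouvillePartial k
  refine ⟨a / (10 * 10 ^ k.factorial), ?_⟩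
  push_cast
  rw [← ha]
  field_simp

/-- The partial sum is a root of `b * X - a` with `b = 10 * 10 ^ k!`. As it is at most 1, `|a| ≤ b`
and the Mahler measure is `b`; the remaining factor 2 comes from `height_le`. -/
lemma height_liouvillePartial_le {k : ℕ} (hk : 1 ≤ k) :
    height (liouvillePartial k : ℂ) ≤ 20 * 10 ^ k.factorial := by
  obtain ⟨a, ha⟩ := exists_int_liouvillePartial k
  obtain ⟨r, hr⟩ := exists_rat_liouvillePartial k
  have halg : IsAlgebraic ℚ (liouvillePartial k : ℂ) := by
    rw [← hr]
    exact isAlgebraic_algebraMap (A := ℂ) r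
  set b : ℤ := 10 * 10 ^ k.factorial with hb
  have hb0 : b ≠ 0 := by positivity
  have haR : |(a : ℝ)| ≤ b := by
    have h1 := liouvillePartial_pos hk
    have h2 := (liouvillePartial_lt k).le.trans liouvilleConstant_le_one
    rw [← ha, abs_mul, abs_of_pos h1, abs_of_pos (by positivity), hb]
    push_cast
    exact mul_le_of_le_one_left (by positivity) h2
  have hdeg : (C b * X + C (-a)).natDegree = 1 := natDegree_linear hb0
  have hne : (C b * X + C (-a)) ≠ 0 := fun h => by rw [h] at hdeg; simp at hdeg
  have hroot : aeval (liouvillePartial k : ℂ) (C b * X + C (-a)) = 0 := by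
    have h1 : (b : ℂ) * (liouvillePartial k : ℂ) = a := by
      rw [mul_comm]
      exact_mod_cast ha
    simp [h1]
  refine (height_le halg hne hroot).trans ?_
  have hmm : intMahler (C b * X + C (-a)) = max ‖(b : ℂ)‖ ‖((-a : ℤ) : ℂ)‖ := by
    rw [intMahler, Polynomial.map_add, Polynomial.map_mul, map_X, map_C, map_C]
    exact mahlerMeasure_C_mul_X_add_C (by simpa using hb0) _
  have hbR : |(b : ℝ)| = 10 * 10 ^ k.factorial := by
    rw [hb]; push_cast; exact abs_of_pos (by positivity)
  rw [hdeg, hmm, Complex.norm_intCast, Complex.norm_intCast, Int.cast_neg, abs_neg, max_eq_left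
    (haR.trans (le_abs_self _)), hbR]
  apply le_of_eq
  ring

lemma natDegree_minpoly_ratCast (r : ℚ) : (minpoly ℚ (r : ℂ)).natDegree = 1 := by
  have := minpoly.eq_X_sub_C (B := ℂ) r
  rw [eq_ratCast] at this
  rw [this, natDegree_X_sub_C]

lemma natDegree_minpoly_mul_ratCast {θ : ℂ} (hθ : IsAlgebraic ℚ θ) {r : ℚ} (hr : r ≠ 0) :
    (minpoly ℚ (θ * r)).natDegree = (minpoly ℚ θ).natDegree := by
  have hr' : (r : ℂ) ≠ 0 := by exact_mod_cast hr
  have halg : IsAlgebraic ℚ (θ * r) := hθ.mul (isAlgebraic_algebraMap (A := ℂ) r)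
  rw [← IntermediateField.adjoin.finrank halg.isIntegral,
    ← IntermediateField.adjoin.finrank hθ.isIntegral]
  have h : IntermediateField.adjoin ℚ {θ * (r : ℂ)} = IntermediateField.adjoin ℚ {θ} := by
    apply le_antisymm
    · rw [IntermediateField.adjoin_simple_le_iff]
      exact mul_mem (IntermediateField.mem_adjoin_simple_self ℚ θ)
        ((IntermediateField.adjoin ℚ {θ}).algebraMap_mem r)
    · rw [IntermediateField.adjoin_simple_le_iff]
      have h1 := mul_mem (IntermediateField.mem_adjoin_simple_self ℚ (θ * (r : ℂ)))
        ((IntermediateField.adjoin ℚ {θ * (r : ℂ)}).algebraMap_mem r⁻¹)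
      rw [eq_ratCast, Rat.cast_inv, mul_inv_cancel_right₀ hr'] at h1
      exact h1
  rw [h]

/-- Take the least admissible `k > M`. If `k = M + 1`, the constant `c` suffices. Otherwise `k - 1 =
M + 1 + t` fails, so `(10 ^ (k-1)!) ^ (t + 1) < Y`, and `10 ^ k! = (10 ^ (k-1)!) ^ k` with `k = M +
2 + t ≤ (t + 1) * (M + 2)`. -/
lemma exists_factorial_growth (M : ℕ) : ∃ c : ℝ, 1 ≤ c ∧ ∀ Y : ℝ, 1 ≤ Y → ∃ k : ℕ, M < k ∧
    Y ≤ ((10 : ℝ) ^ k.factorial) ^ (k - M) ∧ (10 : ℝ) ^ k.factorial ≤ c * Y ^ (M + 2) := by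
  classical
  refine ⟨10 ^ (M + 1).factorial, one_le_pow₀ (by norm_num), fun Y hY => ?_⟩
  have hex : ∃ s : ℕ, Y ≤ ((10 : ℝ) ^ (M + 1 + s).factorial) ^ (s + 1) := by
    obtain ⟨s, hs⟩ := pow_unbounded_of_one_lt Y (by norm_num : (1 : ℝ) < 10)
    refine ⟨s, hs.le.trans ?_⟩
    rw [← pow_mul]
    refine pow_le_pow_right₀ (by norm_num) ?_
    nlinarith [Nat.self_le_factorial (M + 1 + s), Nat.factorial_pos (M + 1 + s)]
  have hspec := Nat.find_spec hex
  have hmin := fun t => Nat.find_min (m := t) hex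
  generalize Nat.find hex = s at hspec hmin
  refine ⟨M + 1 + s, by omega, by rwa [show M + 1 + s - M = s + 1 by omega], ?_⟩
  rcases s with _ | t
  · exact le_mul_of_one_le_right (by positivity) (one_le_pow₀ hY)
  · have h1 := not_le.1 (hmin t (Nat.lt_succ_self t))
    have hb : (1 : ℝ) ≤ 10 ^ (M + 1 + t).factorial := one_le_pow₀ (by norm_num)
    have h2 : (10 : ℝ) ^ (M + 1 + (t + 1)).factorial =
        (10 ^ (M + 1 + t).factorial) ^ (M + 2 + t) := by
      rw [← pow_mul, ← add_assoc, Nat.factorial_succ, mul_comm]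
      congr 2
      omega
    calc _ = _ := h2
      _ ≤ ((10 : ℝ) ^ (M + 1 + t).factorial) ^ ((t + 1) * (M + 2)) :=
        pow_le_pow_right₀ hb (by nlinarith)
      _ = (((10 : ℝ) ^ (M + 1 + t).factorial) ^ (t + 1)) ^ (M + 2) := by rw [pow_mul]
      _ ≤ Y ^ (M + 2) := by gcongr
      _ ≤ _ := le_mul_of_one_le_left (by positivity) (one_le_pow₀ (by norm_num))

/-! ### The type of `θ * ℓ ^ j`. -/

section Monomial

variable {θ : ℝ} {j : ℕ}

lemma isAlgebraic_mul_liouvillePartial (hθ : IsAlgebraic ℚ (θ : ℂ)) (j k : ℕ) :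
    IsAlgebraic ℚ ((θ * liouvillePartial k ^ j : ℝ) : ℂ) := by
  obtain ⟨r, hr⟩ := exists_rat_liouvillePartial k
  rw [← hr]
  push_cast
  exact hθ.mul ((isAlgebraic_algebraMap (A := ℂ) r).pow j)

lemma natDegree_minpoly_mul_liouvillePartial (hθ : IsAlgebraic ℚ (θ : ℂ)) (j : ℕ) {k : ℕ}
    (hk : 1 ≤ k) : (minpoly ℚ ((θ * liouvillePartial k ^ j : ℝ) : ℂ)).natDegree =
      (minpoly ℚ (θ : ℂ)).natDegree := by
  obtain ⟨r, hr⟩ := exists_rat_liouvillePartial k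
  have hr0 : r ≠ 0 := by
    rintro rfl
    exact (liouvillePartial_pos hk).ne (by rw [← hr, Rat.cast_zero])
  rw [← hr, ← natDegree_minpoly_mul_ratCast hθ (pow_ne_zero j hr0)]
  push_cast
  rfl

/-- The general height and Lipschitz estimates, applied to `θ * x ^ j` at `ℓ` and its rational
approximations. -/
lemma exists_height_mul_liouvillePartial_le (hθ : IsAlgebraic ℚ (θ : ℂ)) (j : ℕ) :
    ∃ (A : ℝ) (e k₀ : ℕ), 1 ≤ A ∧ 1 ≤ k₀ ∧ ∀ k, k₀ ≤ k →
      height ((θ * liouvillePartial k ^ j : ℝ) : ℂ) ≤ A * (10 ^ k.factorial) ^ e ∧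
      ‖((θ * liouvilleConstant ^ j : ℝ) : ℂ) - ((θ * liouvillePartial k ^ j : ℝ) : ℂ)‖ ≤
        A / (10 ^ k.factorial) ^ k := by
  set p : ℂ[X] := C (θ : ℂ) * X ^ j with hp
  have hpm : p ∈ algPoly := mul_mem (C_mem_algPoly hθ) (pow_mem X_mem_algPoly j)
  have hev : ∀ x : ℝ, p.eval (x : ℂ) / (1 : ℂ[X]).eval (x : ℂ) = ((θ * x ^ j : ℝ) : ℂ) := by
    intro x
    simp [hp]
  obtain ⟨K, e, D, E, hK, hE, hF⟩ := exists_height_div_le hpm (one_mem algPoly)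
    transcendental_liouvilleConstant (by simp) 1
  obtain ⟨C, δ, hC, hδ, hlip⟩ := exists_lipschitz p 1 (ξ := (liouvilleConstant : ℂ)) (by simp)
  have hinj : Function.Injective fun k => (liouvillePartial k : ℂ) :=
    Complex.ofReal_injective.comp liouvillePartial_strictMono.injective
  obtain ⟨k₁, hk₁⟩ := (hE.preimage hinj.injOn).bddAbove
  obtain ⟨k₂, hk₂⟩ := exists_nat_gt δ⁻¹
  -- Past `k₁` the partial sums avoid the exceptional set; past `k₂` they lie within `δ` of `ℓ`.
  refine ⟨max C (K * 20 ^ e), e, k₁ + k₂ + 1, hC.trans (le_max_left _ _), by omega,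
    fun k hk => ?_⟩
  have hk1 : 1 ≤ k := by omega
  constructor
  · have hkE : (liouvillePartial k : ℂ) ∉ E := fun h => by
      have := hk₁ h
      omega
    obtain ⟨r, hr⟩ := exists_rat_liouvillePartial k
    have h1 := hF (liouvillePartial k) (by
      rw [← hr]; exact isAlgebraic_algebraMap (A := ℂ) r) (by
      rw [← hr]; exact natDegree_minpoly_ratCast r) hkE
    have h2 := h1.2.2.2
    rw [hev] at h2
    refine h2.trans ?_
    have h3 := height_liouvillePartial_le hk1
    have h4 := height_pos (liouvillePartial k : ℂ)
    generalize height (liouvillePartial k : ℂ) = H at h3 h4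
    calc K * H ^ e ≤ K * (20 * 10 ^ k.factorial) ^ e := by gcongr
      _ = (K * 20 ^ e) * (10 ^ k.factorial) ^ e := by rw [mul_pow]; ring
      _ ≤ _ := by gcongr; exact le_max_right _ _
  · have h1 := norm_liouvilleConstant_sub_le k
    have h2 : (1 : ℝ) / (10 ^ k.factorial) ^ k < δ := by
      rw [one_div, inv_lt_comm₀ (by positivity) hδ]
      refine hk₂.trans_le ?_
      have h3 : (k : ℝ) ≤ 10 ^ k := by
        exact_mod_cast (Nat.lt_pow_self (by norm_num)).le
      have h4 : (k₂ : ℝ) ≤ k := by exact_mod_cast (by omega : k₂ ≤ k)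
      refine h4.trans (h3.trans ?_)
      exact pow_le_pow_left₀ (by norm_num) (le_self_pow₀ (by norm_num)
        (Nat.factorial_pos k).ne') k
    have h3 := hlip _ (h1.trans_lt h2)
    rw [hev, hev] at h3
    refine h3.trans ?_
    rw [div_eq_mul_one_div]
    exact mul_le_mul (le_max_left _ _) h1 (norm_nonneg _) (by positivity)

lemma omegaStar_mul_liouville_eq_top (hθ0 : θ ≠ 0) (hθ : IsAlgebraic ℚ (θ : ℂ)) (hj : 1 ≤ j) :
    omegaStar (minpoly ℚ (θ : ℂ)).natDegree ((θ * liouvilleConstant ^ j : ℝ) : ℂ) = ⊤ := by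
  obtain ⟨A, e, k₀, hA, hk₀, h⟩ := exists_height_mul_liouvillePartial_le hθ j
  rw [omegaStar_eq_top_iff]
  intro w hw
  obtain ⟨N, hN⟩ := exists_nat_ge (w + 1)
  obtain ⟨a, ha⟩ := exists_nat_ge A
  -- With `b = 10 ^ k!`, the summand `a` ensures `A ≤ b`, so the height is at most `b ^ (e + 1)`;
  -- the last summand makes `k` exceed the exponent `(e + 1) * N + 1` needed below.
  set k₁ := k₀ + a + ((e + 1) * N + 2) with hk₁
  refine Set.infinite_of_injective_forall_mem
    (f := fun i : ℕ => ((θ * liouvillePartial (k₁ + i) ^ j : ℝ) : ℂ)) ?_ fun i => ?_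
  · intro i i' hii
    have h1 := mul_left_cancel₀ hθ0 (Complex.ofReal_injective hii)
    have h2 := (pow_left_inj₀ (liouvillePartial_pos (by omega)).le
      (liouvillePartial_pos (by omega)).le (by omega)).1 h1
    have := liouvillePartial_strictMono.injective h2
    omega
  generalize hk : k₁ + i = k
  have hk1 : 1 ≤ k := by omega
  obtain ⟨h1, h2⟩ := h k (by omega)
  refine ⟨isAlgebraic_mul_liouvillePartial hθ j k, natDegree_minpoly_mul_liouvillePartial hθ j hk1,
    fun _ => Complex.ofReal_im _, ?_, h2.trans_lt ?_⟩
  · rw [norm_pos_iff, sub_ne_zero]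
    intro he
    have h3 := mul_left_cancel₀ hθ0 (Complex.ofReal_injective he)
    have h4 := (pow_left_inj₀ liouvilleConstant_pos.le
      (liouvillePartial_pos hk1).le (by omega)).1 h3
    exact (liouvillePartial_lt k).ne' h4
  have h3 := height_pos ((θ * liouvillePartial k ^ j : ℝ) : ℂ)
  have h4 := one_le_height ((θ * liouvillePartial k ^ j : ℝ) : ℂ)
  generalize height ((θ * liouvillePartial k ^ j : ℝ) : ℂ) = H at h1 h3 h4
  set b : ℝ := 10 ^ k.factorial with hb
  have hb1 : 1 < b := one_lt_pow₀ (by norm_num) (Nat.factorial_pos k).ne'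
  have hAb : A ≤ b := by
    have h5 : (k : ℝ) ≤ 10 ^ k := by
      exact_mod_cast (Nat.lt_pow_self (by norm_num)).le
    have h6 : (a : ℝ) ≤ k := by exact_mod_cast (by omega : a ≤ k)
    exact ha.trans (h6.trans (h5.trans (pow_le_pow_right₀ (by norm_num)
      (Nat.self_le_factorial k))))
  have h5 : H ^ (w + 1) ≤ b ^ ((e + 1) * N) := by
    calc H ^ (w + 1) ≤ H ^ (N : ℝ) := Real.rpow_le_rpow_of_exponent_le h4 hN
      _ = H ^ N := Real.rpow_natCast _ _
      _ ≤ (b * b ^ e) ^ N := by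
        refine pow_le_pow_left₀ h3.le (h1.trans ?_) N
        gcongr
      _ = b ^ ((e + 1) * N) := by rw [← pow_succ', ← pow_mul]
  rw [show -w - 1 = -(w + 1) by ring, Real.rpow_neg h3.le, div_lt_iff₀ (by positivity),
    inv_mul_eq_div, lt_div_iff₀ (by positivity)]
  calc A * H ^ (w + 1) ≤ b * b ^ ((e + 1) * N) := by gcongr
    _ = b ^ ((e + 1) * N + 1) := by rw [pow_succ']
    _ < b ^ k := pow_lt_pow_right₀ hb1 (by omega)

/-- By Liouville's inequality a `β` of degree `n < d` stays away from each `x = θ * ℓ_k ^ j`, where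
`ℓ_k` is the `k`-th partial sum. Choose `k` so that the distance from `x` to the limit is at most
half this bound while `10 ^ k!` is polynomial in `H(β)`; the triangle inequality gives a polynomial
lower bound for the distance from `β` to the limit. -/
lemma omegaStar_mul_liouville_lt_top (hθ : IsAlgebraic ℚ (θ : ℂ)) (j : ℕ) {n : ℕ}
    (hn : n < (minpoly ℚ (θ : ℂ)).natDegree) :
    omegaStar n ((θ * liouvilleConstant ^ j : ℝ) : ℂ) < ⊤ := by
  obtain ⟨A, e, k₀, hA, hk₀, h⟩ := exists_height_mul_liouvillePartial_le hθ j
  set d := (minpoly ℚ (θ : ℂ)).natDegree with hd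
  -- The term `e * n` is the power of `10 ^ k!` in Liouville's inequality; adding `k₀` makes `k > M`
  -- imply `k ≥ k₀`.
  set M := e * n + k₀ with hM
  obtain ⟨c, hc, hgrow⟩ := exists_factorial_growth M
  set K : ℝ := 2 ^ (d * n) * (n + 1) ^ d * ((d + 1) * A) ^ n with hK
  have hK1 : 1 ≤ K := by
    refine one_le_mul_of_one_le_of_one_le (one_le_mul_of_one_le_of_one_le
      (one_le_pow₀ one_le_two) (one_le_pow₀ (by simp))) (one_le_pow₀ ?_)
    exact one_le_mul_of_one_le_of_one_le (by simp) hA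
  refine omegaStar_lt_top (k := d + d * (M + 2) * M)
    (C := 2 * K * (c * (2 * A * K) ^ (M + 2)) ^ M) Set.finite_empty fun β hβ hβn _ => ?_
  have hH0 := height_pos β
  have hH1 := one_le_height β
  have hlio : ∀ k, M < k → 1 ≤ ‖((θ * liouvillePartial k ^ j : ℝ) : ℂ) - β‖ *
      (K * height β ^ d * (10 ^ k.factorial) ^ M) := by
    intro k hk
    have h1 := (h k (by omega)).1
    have hdk := natDegree_minpoly_mul_liouvillePartial hθ j (k := k) (by omega)
    have h2 := one_le_of_minpoly_ne (isAlgebraic_mul_liouvillePartial hθ j k) hβ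
      (fun he => by rw [he, hβn] at hdk; omega) hdk hβn
    have h3 := height_pos ((θ * liouvillePartial k ^ j : ℝ) : ℂ)
    generalize height ((θ * liouvillePartial k ^ j : ℝ) : ℂ) = a at h1 h2 h3
    generalize height β = H at hH0 hH1 h2
    refine h2.trans (mul_le_mul_of_nonneg_left ?_ (norm_nonneg _))
    have hb1 : (1 : ℝ) ≤ 10 ^ k.factorial := one_le_pow₀ (by norm_num)
    generalize (10 : ℝ) ^ k.factorial = b at h1 hb1
    calc 2 ^ (d * n) * ((n + 1) * H) ^ d * ((d + 1) * a) ^ n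
        ≤ 2 ^ (d * n) * ((n + 1) * H) ^ d * ((d + 1) * (A * b ^ e)) ^ n := by gcongr
      _ = K * H ^ d * b ^ (e * n) := by
        rw [hK, mul_pow _ H, ← mul_assoc ((d : ℝ) + 1), mul_pow _ (b ^ e), ← pow_mul]
        ring
      _ ≤ _ := by
        gcongr
        omega
  have hdist := fun k hk => (h k hk).2
  generalize height β = H at hH0 hH1 hlio
  have hHd : 1 ≤ H ^ d := one_le_pow₀ hH1
  -- This `Y` is what `b ^ (k - M)` must exceed for `h3`, the bound by `1 / 2`.
  have hY : 1 ≤ 2 * A * K * H ^ d :=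
    one_le_mul_of_one_le_of_one_le (one_le_mul_of_one_le_of_one_le (by linarith) hK1) hHd
  obtain ⟨k, hkM, hYk, hbk⟩ := hgrow _ hY
  have h1 := hlio k hkM
  have h2 := hdist k (by omega)
  have hb1 : (1 : ℝ) ≤ 10 ^ k.factorial := one_le_pow₀ (by norm_num)
  generalize (10 : ℝ) ^ k.factorial = b at h1 h2 hYk hbk hb1
  have hb0 : 0 < b := by linarith
  set x := ((θ * liouvillePartial k ^ j : ℝ) : ℂ)
  set z := ((θ * liouvilleConstant ^ j : ℝ) : ℂ)
  have hP : 0 < K * H ^ d * b ^ M := by positivity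
  have h3 : ‖z - x‖ * (K * H ^ d * b ^ M) ≤ 1 / 2 := by
    calc _ ≤ A / b ^ k * (K * H ^ d * b ^ M) := by gcongr
      _ = (2 * A * K * H ^ d) / b ^ (k - M) / 2 := by
        rw [← Nat.sub_add_cancel hkM.le, pow_add, Nat.add_sub_cancel]
        field_simp
      _ ≤ 1 / 2 := by
        gcongr
        rw [div_le_one (by positivity)]
        exact hYk
  have h4 : ‖x - β‖ ≤ ‖z - x‖ + ‖z - β‖ := by
    rw [norm_sub_rev z x]
    exact norm_sub_le_norm_sub_add_norm_sub x z β
  have h5 : 1 ≤ ‖z - β‖ * (2 * (K * H ^ d * b ^ M)) := by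
    have := mul_le_mul_of_nonneg_right h4 hP.le
    nlinarith
  refine h5.trans (mul_le_mul_of_nonneg_left ?_ (norm_nonneg _))
  calc 2 * (K * H ^ d * b ^ M) ≤ 2 * (K * H ^ d * (c * (2 * A * K * H ^ d) ^ (M + 2)) ^ M) := by
        gcongr
    _ = _ := by
        rw [mul_pow (2 * A * K) (H ^ d), ← mul_assoc c, mul_pow _ ((H ^ d) ^ (M + 2)), ← pow_mul,
          ← pow_mul, pow_add H]
        ring

/-- For `θ ≠ 0` real algebraic of degree `d`, the number `θ * ℓ ^ j` is a `U`-number of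
type `d`. -/
theorem isUNumber_mul_liouville (hθ0 : θ ≠ 0) (hθ : IsAlgebraic ℚ (θ : ℂ)) (hj : 1 ≤ j) :
    IsUNumber (minpoly ℚ (θ : ℂ)).natDegree ((θ * liouvilleConstant ^ j : ℝ) : ℂ) :=
  ⟨minpoly.natDegree_pos hθ.isIntegral, omegaStar_mul_liouville_eq_top hθ0 hθ hj,
    fun _ _ hn => omegaStar_mul_liouville_lt_top hθ j hn⟩

end Monomial

/-! ### The type map is well defined. -/

lemma not_isPole {F : RatFunc Qbar} {ξ : ℂ} (hξ : Transcendental ℚ ξ) :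
    ¬ IsPole F ξ := by
  intro h
  have h1 : F.denom.map (algebraMap Qbar ℂ) = 0 :=
    eq_zero_of_eval_transcendental hξ ⟨F.denom, rfl⟩ (by rwa [eval_map])
  exact F.denom_ne_zero ((Polynomial.map_eq_zero _).1 h1)

lemma value_eq (F : RatFunc Qbar) (z : ℂ) : value F z =
    (F.num.map (algebraMap Qbar ℂ)).eval z / (F.denom.map (algebraMap Qbar ℂ)).eval z := by
  rw [eval_map, eval_map]
  rfl

/-- If `F(ξ) = c` were algebraic, `F.num - c * F.denom` would vanish at `ξ`, hence identically, and
`F` would be constant. -/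
lemma transcendental_value {F : RatFunc Qbar} (hF : F ∈ NonconstRatFunc) {ξ : ℂ}
    (hξ : Transcendental ℚ ξ) : Transcendental ℚ (value F ξ) := by
  intro halg
  have hd : (F.denom.map (algebraMap Qbar ℂ)).eval ξ ≠ 0 := by
    rw [eval_map]
    exact not_isPole hξ
  set c : Qbar := ⟨value F ξ, mem_algebraicClosure_iff.2 halg⟩ with hc
  have h0 : (F.num - C c * F.denom).map (algebraMap Qbar ℂ) = 0 := by
    refine eq_zero_of_eval_transcendental hξ ⟨_, rfl⟩ ?_
    have hc' : algebraMap Qbar ℂ c = value F ξ := rfl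
    rw [Polynomial.map_sub, Polynomial.map_mul, map_C, hc', eval_sub, eval_mul, eval_C, value_eq,
      div_mul_cancel₀ _ hd, sub_self]
  rw [Polynomial.map_eq_zero, sub_eq_zero] at h0
  refine hF c ?_
  have hd' : algebraMap Qbar[X] (RatFunc Qbar) F.denom ≠ 0 :=
    RatFunc.algebraMap_ne_zero F.denom_ne_zero
  rw [← F.num_div_denom, h0, map_mul, mul_div_cancel_right₀ _ hd', RatFunc.algebraMap_C]

lemma exists_isUNumber_value {m : ℕ} {ξ : ℝ} (hξ : ξ ∈ UNumbers m) {F : RatFunc Qbar}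
    (hF : F ∈ NonconstRatFunc) : ∃ s, IsUNumber s (value F (ξ : ℂ)) := by
  have ht := IsUNumber.transcendental hξ
  have hv := transcendental_value hF ht
  rw [value_eq] at hv ⊢
  refine IsUNumber.div hξ (Complex.ofReal_im ξ) ⟨F.num, rfl⟩ ⟨F.denom, rfl⟩ ?_ hv
  rw [eval_map]
  exact not_isPole ht

theorem existsUnique_isTypeMap (m : ℕ) :
    ∃! ψ : UNumbers m × NonconstRatFunc → ℕ+, IsTypeMap m ψ := by
  have hex : ∀ x : UNumbers m × NonconstRatFunc,
      ∃ s : ℕ+, IsUNumber (s : ℕ) (value x.2.1 ((x.1.1 : ℝ) : ℂ)) := fun x => by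
    obtain ⟨s, hs⟩ := exists_isUNumber_value x.1.2 x.2.2
    exact ⟨⟨s, hs.1⟩, hs⟩
  choose ψ hψ using hex
  refine ⟨ψ, fun ξ F => ⟨not_isPole (IsUNumber.transcendental ξ.2), hψ (ξ, F)⟩,
    fun ψ' hψ' => funext fun x => PNat.coe_injective ?_⟩
  exact (hψ' x.1 x.2).2.unique (hψ x)

/-! ### Radicals of primes (Eisenstein), the explicit pairs and divergence. -/

lemma irreducible_X_pow_sub_prime {n p : ℕ} (hn : 1 ≤ n) (hp : p.Prime) :
    Irreducible (X ^ n - C (p : ℚ)) := by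
  have hm : (X ^ n - C (p : ℤ)).Monic := monic_X_pow_sub_C _ (by omega)
  have hd : (X ^ n - C (p : ℤ)).natDegree = n := natDegree_X_pow_sub_C
  have hp' : Prime (p : ℤ) := Nat.prime_iff_prime_int.1 hp
  have he : (X ^ n - C (p : ℤ)).IsEisensteinAt (Ideal.span {(p : ℤ)}) := by
    refine ⟨?_, fun {i} hi => ?_, ?_⟩
    · rw [hm.leadingCoeff, Ideal.mem_span_singleton]
      exact hp'.not_dvd_one
    · rw [hd] at hi
      rw [coeff_sub, coeff_X_pow, if_neg hi.ne, zero_sub, coeff_C, Ideal.mem_span_singleton]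
      split_ifs <;> simp
    · rw [coeff_sub, coeff_X_pow, if_neg (by omega), zero_sub, coeff_C_zero,
        Ideal.span_singleton_pow, Ideal.mem_span_singleton, dvd_neg, sq]
      intro h
      have h1 : (p : ℤ) * p ∣ p * 1 := by rwa [mul_one]
      exact hp'.not_dvd_one ((mul_dvd_mul_iff_left hp'.ne_zero).1 h1)
  have hirr := he.irreducible ((Ideal.span_singleton_prime hp'.ne_zero).2 hp') hm.isPrimitive
    (by omega)
  have h1 := (IsPrimitive.Int.irreducible_iff_irreducible_map_cast hm.isPrimitive).1 hirr
  simpa using h1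

section Root

variable {n p : ℕ}

lemma ofReal_rpow_one_div_pow (hn : 1 ≤ n) (a : ℕ) :
    (((a : ℝ) ^ (1 / (n : ℝ)) : ℝ) : ℂ) ^ n = a := by
  rw [← Complex.ofReal_pow, one_div, Real.rpow_inv_natCast_pow (by positivity) (by omega)]
  simp

lemma aeval_rpow_one_div (hn : 1 ≤ n) (a : ℕ) :
    aeval (((a : ℝ) ^ (1 / (n : ℝ)) : ℝ) : ℂ) (X ^ n - C (a : ℚ)) = 0 := by
  rw [map_sub, map_pow, aeval_X, aeval_C, ofReal_rpow_one_div_pow hn]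
  simp

lemma isAlgebraic_rpow_one_div (hn : 1 ≤ n) (a : ℕ) :
    IsAlgebraic ℚ (((a : ℝ) ^ (1 / (n : ℝ)) : ℝ) : ℂ) :=
  ⟨_, X_pow_sub_C_ne_zero (by omega) _, aeval_rpow_one_div hn a⟩

lemma natDegree_minpoly_rpow_one_div (hn : 1 ≤ n) (hp : p.Prime) :
    (minpoly ℚ (((p : ℝ) ^ (1 / (n : ℝ)) : ℝ) : ℂ)).natDegree = n := by
  rw [← minpoly.eq_of_irreducible_of_monic (irreducible_X_pow_sub_prime hn hp)
    (aeval_rpow_one_div hn p) (monic_X_pow_sub_C _ (by omega)), natDegree_X_pow_sub_C]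

lemma rpow_one_div_mul_liouville_mem (hn : 1 ≤ n) (hp : p.Prime) :
    (p : ℝ) ^ (1 / (n : ℝ)) * liouvilleConstant ∈ UNumbers n := by
  have hp0 : (0 : ℝ) < p := by exact_mod_cast hp.pos
  have h := isUNumber_mul_liouville (Real.rpow_pos_of_pos hp0 _).ne'
    (isAlgebraic_rpow_one_div hn p) le_rfl
  rwa [natDegree_minpoly_rpow_one_div hn hp, pow_one] at h

lemma C_mul_X_pow_mem {c : Qbar} (hc : c ≠ 0) (hn : 1 ≤ n) :
    RatFunc.C c * RatFunc.X ^ n ∈ NonconstRatFunc := by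
  intro c' h
  rw [← RatFunc.algebraMap_C, ← RatFunc.algebraMap_X, ← RatFunc.algebraMap_C, ← map_pow,
    ← map_mul] at h
  have h1 := congrArg natDegree (RatFunc.algebraMap_injective Qbar h)
  rw [natDegree_C_mul_X_pow n c hc, natDegree_C] at h1
  omega

lemma value_C_mul_X_pow (c : Qbar) (n : ℕ) (z : ℂ) :
    value (RatFunc.C c * RatFunc.X ^ n) z = c * z ^ n := by
  rw [← RatFunc.algebraMap_C, ← RatFunc.algebraMap_X, ← map_pow, ← map_mul, value,
    RatFunc.eval_algebraMap]
  simp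

end Root

lemma IsTypeMap.exists_mem_preimage {m : ℕ} (hm : 1 ≤ m) {ψ : UNumbers m × NonconstRatFunc → ℕ+}
    (hψ : IsTypeMap m ψ) (s : ℕ+) {p : ℕ} (hp : p.Prime) : ∃ x ∈ ψ ⁻¹' {s},
      (x.1 : ℝ) = (p : ℝ) ^ (1 / (m : ℝ)) * liouvilleConstant ∧
      ∃ c : Qbar, (c : ℂ) = (((2 : ℝ) ^ (1 / ((s : ℕ) : ℝ)) : ℝ) : ℂ) ∧
        (x.2 : RatFunc Qbar) = RatFunc.C c * RatFunc.X ^ m := by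
  set θ : ℝ := ((2 : ℕ) : ℝ) ^ (1 / ((s : ℕ) : ℝ)) with hθ
  have hθ0 : θ ≠ 0 := (Real.rpow_pos_of_pos (by norm_num) _).ne'
  have hs : 1 ≤ (s : ℕ) := s.2
  have halg : IsAlgebraic ℚ (θ : ℂ) := isAlgebraic_rpow_one_div hs 2
  set c : Qbar := ⟨(θ : ℂ), mem_algebraicClosure_iff.2 halg⟩ with hc
  have hc0 : c ≠ 0 := fun h => hθ0 (by
    have h1 : (θ : ℂ) = 0 := congrArg (fun x : Qbar => (x : ℂ)) h
    exact_mod_cast h1)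
  set x : UNumbers m × NonconstRatFunc :=
    (⟨_, rpow_one_div_mul_liouville_mem hm hp⟩, ⟨_, C_mul_X_pow_mem hc0 hm⟩) with hx
  refine ⟨x, ?_, rfl, c, ?_, rfl⟩
  · have hp0 : (p : ℚ) ≠ 0 := by exact_mod_cast hp.ne_zero
    have halg' : IsAlgebraic ℚ ((θ * p : ℝ) : ℂ) := by
      push_cast
      exact halg.mul (isAlgebraic_natCast p)
    -- The value is `θ * p * ℓ ^ m`, and the rational factor `p` does not change the degree `s` of
    -- `θ = 2^{1/s}`.
    have hdeg : (minpoly ℚ ((θ * p : ℝ) : ℂ)).natDegree = s := by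
      rw [← natDegree_minpoly_rpow_one_div hs Nat.prime_two,
        ← natDegree_minpoly_mul_ratCast halg hp0]
      push_cast
      rfl
    have hU := isUNumber_mul_liouville (mul_ne_zero hθ0 (by exact_mod_cast hp.ne_zero)) halg' hm
    have hval : value x.2.1 ((x.1 : ℝ) : ℂ) = ((θ * p * liouvilleConstant ^ m : ℝ) : ℂ) := by
      rw [hx, value_C_mul_X_pow, Complex.ofReal_mul, mul_pow, ofReal_rpow_one_div_pow hm, hc]
      push_cast
      ring
    rw [hdeg, ← hval] at hU
    exact PNat.coe_injective ((hψ x.1 x.2).2.unique hU)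
  · simp [hc, hθ]

/-- Since `p^{1/m} ≤ p` and `ℓ ≤ 1`, each term is at least `1 / p`, and the sum of `1 / p` over the
primes diverges. -/
lemma not_summable_one_div_rpow_mul_liouville {m : ℕ} (hm : 1 ≤ m) :
    ¬ Summable fun p : Nat.Primes =>
      1 / (((p : ℕ) : ℝ) ^ (1 / (m : ℝ)) * liouvilleConstant) := by
  intro h
  refine Nat.Primes.not_summable_one_div (h.of_nonneg_of_le (fun _ => by positivity) fun p => ?_)
  have hp : (1 : ℝ) ≤ (p : ℕ) := by exact_mod_cast p.2.one_le
  have h1 : ((p : ℕ) : ℝ) ^ (1 / (m : ℝ)) ≤ (p : ℕ) := by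
    refine (Real.rpow_le_rpow_of_exponent_le hp ?_).trans_eq (Real.rpow_one _)
    rw [div_le_one (by positivity)]
    exact_mod_cast hm
  have h2 : (0 : ℝ) < ((p : ℕ) : ℝ) ^ (1 / (m : ℝ)) := Real.rpow_pos_of_pos (by linarith) _
  refine one_div_le_one_div_of_le (mul_pos h2 liouvilleConstant_pos) ?_
  exact (mul_le_of_le_one_right h2.le liouvilleConstant_le_one).trans h1

lemma rpow_one_div_mul_liouville_injective {m : ℕ} (hm : 1 ≤ m) :
    Function.Injective fun p : Nat.Primes =>
      ((p : ℕ) : ℝ) ^ (1 / (m : ℝ)) * liouvilleConstant := by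
  intro p q h
  have h1 := mul_right_cancel₀ liouvilleConstant_pos.ne' h
  have h2 := Real.rpow_left_injOn (x := 1 / (m : ℝ)) (by positivity)
    (Set.mem_ofPred_eq ▸ Nat.cast_nonneg _) (Set.mem_ofPred_eq ▸ Nat.cast_nonneg _) h1
  exact Subtype.ext (by exact_mod_cast h2)

end Koksma

end

theorem corollary3 (m : ℕ) (hm : 1 ≤ m) :
    (∃! ψ : Koksma.UNumbers m × Koksma.NonconstRatFunc → ℕ+, Koksma.IsTypeMap m ψ) ∧
    ∀ ψ : Koksma.UNumbers m × Koksma.NonconstRatFunc → ℕ+, Koksma.IsTypeMap m ψ →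
      (∀ s : ℕ+, (ψ ⁻¹' {s}).Infinite) ∧
      Function.Surjective ψ ∧
      (∀ s : ℕ+, ¬ Summable fun ξ : (Prod.fst '' (ψ ⁻¹' {s}) : Set (Koksma.UNumbers m)) =>
        1 / ((ξ : Koksma.UNumbers m) : ℝ)) ∧
      (∀ s : ℕ+, ∀ p : ℕ, p.Prime → ∃ x ∈ ψ ⁻¹' {s},
        (x.1 : ℝ) = (p : ℝ) ^ (1 / (m : ℝ)) * Koksma.liouvilleConstant ∧
        ∃ c : Koksma.Qbar, (c : ℂ) = (((2 : ℝ) ^ (1 / ((s : ℕ) : ℝ)) : ℝ) : ℂ) ∧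
          (x.2 : RatFunc Koksma.Qbar) = RatFunc.C c * RatFunc.X ^ m) ∧
      ¬ Summable fun p : Nat.Primes =>
        1 / (((p : ℕ) : ℝ) ^ (1 / (m : ℝ)) * Koksma.liouvilleConstant) := by
  refine ⟨Koksma.existsUnique_isTypeMap m, fun ψ hψ => ?_⟩
  have hpair : ∀ (s : ℕ+) (p : Nat.Primes), ∃ x ∈ ψ ⁻¹' {s},
      (x.1 : ℝ) = ((p : ℕ) : ℝ) ^ (1 / (m : ℝ)) * Koksma.liouvilleConstant := fun s p => by
    obtain ⟨x, hx, h, -⟩ := hψ.exists_mem_preimage hm s p.2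
    exact ⟨x, hx, h⟩
  choose x hx hxp using hpair
  have hinj : ∀ s, Function.Injective fun p => ((x s p).1 : ℝ) := fun s p q h => by
    simp only [hxp] at h
    exact Koksma.rpow_one_div_mul_liouville_injective hm h
  refine ⟨fun s => ?_, fun s => ?_, fun s hsum => ?_, fun s p hp => hψ.exists_mem_preimage hm s hp,
    Koksma.not_summable_one_div_rpow_mul_liouville hm⟩
  · exact Set.infinite_of_injective_forall_mem
      (f := x s) (fun p q h => hinj s (by simp only [h])) (hx s)
  · exact ⟨x s ⟨2, Nat.prime_two⟩, hx s _⟩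
  · refine Koksma.not_summable_one_div_rpow_mul_liouville hm ?_
    -- The primes inject into the index set, so summability would pass to this subfamily.
    have h := hsum.comp_injective
      (i := fun p : Nat.Primes => ⟨(x s p).1, Set.mem_image_of_mem _ (hx s p)⟩)
      (fun p q h => hinj s (by
        have := congrArg (fun y => ((y.1 : Koksma.UNumbers m) : ℝ)) h
        exact this))
    refine h.congr fun p => ?_
    simp only [Function.comp, hxp]
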